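/- Let $M>0$, $e\in\mathbb R$ with $e^2<M^2$, $r_\pm=M\pm\sqrt{M^2-e^2}$, and $f(\rho)=1-\frac{2M}{\rho}+\frac{e^2}{\rho^2}$ (non-extremal Reissner–Nordström black hole in two space dimensions, polar coordinates $(\rho,\varphi)$, time $x_0$). Put $$\langle u,v\rangle=i\int_0^\infty\!\!\int_0^{2\pi}\Big[(2-f)(\bar u\,\partial_{x_0}v-\partial_{x_0}\bar u\,v)+(f-1)(\bar u\,\partial_\rho v-\partial_\rho\bar u\,v)\Big]_{x_0=0}\rho\,d\varphi\,d\rho .$$ This Klein–Gordon product depends only on the Cauchy data of $u,v$ at $x_0=0$; everything below holds for arbitrary functions with the stated Cauchy data, in particular for the solutions of the wave equation with these data. Let $a>0$. For $k=(\eta_\rho,m')\in\mathbb R\times\mathbb Z$ let $f_k^\pm$ have the Cauchy data $f_k^\pm|_{x_0=0}=\gamma_ke^{i(\rho\eta_\rho+m'\varphi)}$, $\partial_{x_0}f_k^\pm|_{x_0=0}=i\lambda_0^\mp(k)\gamma_ke^{i(\rho\eta_\rho+m'\varphi)}$, where $$\gamma_k=\frac{1}{\sqrt\rho\,(\eta_\rho^2+a^2)^{1/4}}\cdot\frac1{\sqrt2\,2\pi},\qquad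 \lambda_0^\pm(k)=\frac{-(f-1)\eta_\rho\pm\sqrt{\eta_\rho^2+a^2}}{2-f}.$$ For a wave packet $C$ put $C^+(k)=\langle f_k^+,C\rangle$, $C^-(k)=-\langle f_{-k}^-,C\rangle$. On the bosonic Fock space over $L^2(\mathbb R\times\mathbb Z)$, with annihilation operators $\alpha_k^+$, creation operators $\alpha_{-k}^-=(\alpha_k^+)^*$ and vacuum $|0\rangle$ (so $\alpha_k^+|0\rangle=0$), put $$\langle C,\Phi\rangle=\sum_{m'}\int\big(\overline{C^+(k)}\,\alpha_k^+-\overline{C^-(k)}\,\alpha_{-k}^-\big)d\eta_\rho,\qquad N(C)=\langle C,\Phi\rangle^*\langle C,\Phi\rangle .$$ Let $\varepsilon>0$, $\eta_0>0$, $m\in\mathbb Z$, $\hat\xi_0=\frac{2\eta_0r_+^2}{r_+-r_-}$, and let $\hat C$ have the Cauchy data $$\hat C|_{x_0=0}=\theta(\rho-r_+)\frac1{\sqrt\rho}(\rho-r_+)^\varepsilon e^{-a(\rho-r_+)}e^{i\hat\xi_0\ln(\rho-r_+)+im\varphi},\qquad \partial_{x_0}\hat C|_{x_0=0}=i\hat\beta\,\hat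 C|_{x_0=0},\quad \hat\beta=\frac{-f\,\hat\xi_0}{(2-f)(\rho-r_+)} .$$ Let $\hat C_n=\hat C/\langle\hat C,\hat C\rangle^{1/2}$ (with the same $a$ as in $f_k^\pm$). Define $\Gamma_1$ by $\Gamma(i\hat\xi_0+\varepsilon)=e^{-\frac\pi2\hat\xi_0}\,\Gamma_1(i\hat\xi_0+\varepsilon)$ and $$\hat C_3(\eta)=\tfrac12e^{-2\pi\hat\xi_0}|\Gamma_1(i\hat\xi_0+\varepsilon)|^2\,|\hat\xi_0+i\varepsilon|^2\,\Big|\frac{\eta}{(\eta^2+1)^{1/4}}+(\eta^2+1)^{1/4}\Big|^2e^{2\hat\xi_0\arg(\eta+i)}(\eta^2+1)^{-\varepsilon-1}.$$ Then for every $a>0$, $\langle\hat C_n,\hat C_n\rangle=1$ and $\hat C_n^\pm\in L^2(\mathbb R\times\mathbb Z)$. Moreover $\hat C_3$ is integrable over $\mathbb R$, and $$\lim_{a\to\infty}\langle0|N(\hat C_n)|0\rangle=\frac{2^{2\varepsilon}}{4\pi\Gamma(2\varepsilon)}\int_{-\infty}^\infty\frac1{\hat\xi_0}\hat C_3(\eta)\,d\eta=I_++I_-,$$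 $$I_+=\frac{2^{2\varepsilon}}{4\pi\Gamma(2\varepsilon)}\int_0^\infty\frac1{\hat\xi_0}\hat C_3(\eta)\,d\eta,\qquad I_-=\frac{2^{2\varepsilon}}{4\pi\Gamma(2\varepsilon)}\int_{-\infty}^0\frac1{\hat\xi_0}\hat C_3(\eta)\,d\eta .$$ Here $I_+$ (called the Hawking part) is the limit of the contribution $\sum_{m'}\int_0^\infty|\hat C_n^-(k)|^2d\eta_\rho$ of the modes with $\eta_\rho>0$, and $I_-$ (the part called not related to Hawking radiation) is the limit of the contribution $\sum_{m'}\int_{-\infty}^0|\hat C_n^-(k)|^2d\eta_\rho$ of the modes with $\eta_\rho<0$. -/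

import Mathlib

open MeasureTheory Filter Topology
open scoped ComplexConjugate

noncomputable section

namespace RN

/-! ### The Reissner-Nordstrom geometry (two space dimensions) and the Klein-Gordon product -/

/-- A function of `(x₀, ρ, φ)`. -/
abbrev SpacetimeFun := ℝ → ℝ → ℝ → ℂ

/-- `f(ρ) = 1 - 2M/ρ + e²/ρ²`, for mass `M` and charge `e`. -/
def f (M e ρ : ℝ) : ℝ := 1 - 2 * M / ρ + e ^ 2 / ρ ^ 2

/-- `r₊ = M + √(M² - e²)`. -/
def rPlus (M e : ℝ) : ℝ := M + √(M ^ 2 - e ^ 2)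

/-- `r₋ = M - √(M² - e²)`. -/
def rMinus (M e : ℝ) : ℝ := M - √(M ^ 2 - e ^ 2)

/-- `∂u/∂x₀` at `(t, ρ, φ)`. -/
def dTime (u : SpacetimeFun) (t ρ φ : ℝ) : ℂ := deriv (fun x₀ => u x₀ ρ φ) t

/-- `∂u/∂ρ` at `(t, ρ, φ)`. -/
def dRho (u : SpacetimeFun) (t ρ φ : ℝ) : ℂ := deriv (fun r => u t r φ) ρ

/-- The Klein-Gordon inner product `⟨u, v⟩` over the slice `x₀ = t`, in polar coordinates:
`i ∫∫ [(2-f)(ū ∂₀v - ∂₀ū v) + (f-1)(ū ∂_ρ v - ∂_ρ ū v)] ρ dρ dφ`. -/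
def kgInner (M e t : ℝ) (u v : SpacetimeFun) : ℂ :=
  Complex.I * ∫ ρ in Set.Ioi (0 : ℝ), ∫ φ in (0 : ℝ)..(2 * Real.pi),
    (((2 - f M e ρ : ℝ) : ℂ) *
        (conj (u t ρ φ) * dTime v t ρ φ - conj (dTime u t ρ φ) * v t ρ φ)
      + ((f M e ρ - 1 : ℝ) : ℂ) *
        (conj (u t ρ φ) * dRho v t ρ φ - conj (dRho u t ρ φ) * v t ρ φ)) * (ρ : ℂ)

/-! ### The mode functions -/

/-- Mode labels `k = (η_ρ, m')`. -/
abbrev Mode := ℝ × ℤ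

/-- `∑_{m'} ∫ dη_ρ` as a measure on the mode labels. -/
def modeMeasure : Measure Mode := (volume : Measure ℝ).prod Measure.count

/-- `γ_k = 1 / (√ρ (η_ρ² + a²)^{1/4}) · 1 / (√2 · 2π)`. -/
def gammaK (a : ℝ) (k : Mode) (ρ : ℝ) : ℝ :=
  1 / (√ρ * (k.1 ^ 2 + a ^ 2) ^ (1 / 4 : ℝ)) * (1 / (√2 * (2 * Real.pi)))

/-- `λ₀^±(k) = (-(f-1) η_ρ ± √(η_ρ² + a²)) / (2 - f)`; `σ = 1` or `σ = -1` is the sign. -/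
def lambda0 (M e a σ : ℝ) (k : Mode) (ρ : ℝ) : ℝ :=
  (-(f M e ρ - 1) * k.1 + σ * √(k.1 ^ 2 + a ^ 2)) / (2 - f M e ρ)

/-- `γ_k e^{i k·x}`, where `k·x = ρ η_ρ + m' φ`. -/
def modeValue (a : ℝ) (k : Mode) (ρ φ : ℝ) : ℂ :=
  (gammaK a k ρ : ℂ) * Complex.exp (Complex.I * ((ρ * k.1 + k.2 * φ : ℝ) : ℂ))

/-- `F` has at `x₀ = 0` the Cauchy data `F = γ_k e^{ik·x}`, `∂₀F = i λ₀^σ(k) γ_k e^{ik·x}`.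
The mode `f_k^+` has these data with `σ = -1`, and `f_k^-` has them with `σ = 1`.
(The exceptional radii `f = 2`, where the slope `λ₀` is undefined, lie inside the horizon.) -/
structure HasModeData (M e a σ : ℝ) (k : Mode) (F : SpacetimeFun) : Prop where
  value : ∀ ρ φ : ℝ, 0 < ρ → F 0 ρ φ = modeValue a k ρ φ
  slope : ∀ ρ φ : ℝ, 0 < ρ → f M e ρ ≠ 2 →
    HasDerivAt (fun x₀ => F x₀ ρ φ)
      (Complex.I * (lambda0 M e a σ k ρ : ℂ) * modeValue a k ρ φ) 0

/-- `C^+(k) = ⟨f_k^+, C⟩`. -/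
def coeffPlus (M e : ℝ) (fp : Mode → SpacetimeFun) (C : SpacetimeFun) (k : Mode) : ℂ :=
  kgInner M e 0 (fp k) C

/-- `C^-(k) = -⟨f_{-k}^-, C⟩`. -/
def coeffMinus (M e : ℝ) (fm : Mode → SpacetimeFun) (C : SpacetimeFun) (k : Mode) : ℂ :=
  -kgInner M e 0 (fm (-k)) C

/-! ### The wave packet -/

/-- `ξ̂₀ = 2 η₀ r₊² / (r₊ - r₋)`. -/
def xi0 (M e η₀ : ℝ) : ℝ := 2 * η₀ * rPlus M e ^ 2 / (rPlus M e - rMinus M e)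

/-- `β̂ = -f (ξ̂₀ / (ρ - r₊)) / (2 - f)`. -/
def beta (M e η₀ ρ : ℝ) : ℝ :=
  -f M e ρ * (xi0 M e η₀ / (ρ - rPlus M e)) / (2 - f M e ρ)

/-- `θ(ρ-r₊) ρ^{-1/2} (ρ-r₊)^ε e^{-a(ρ-r₊)} exp(i ξ̂₀ ln(ρ-r₊) + i m φ)`. -/
def packetValue (M e η₀ ε a : ℝ) (m : ℤ) (ρ φ : ℝ) : ℂ :=
  if rPlus M e < ρ then
    ((1 / √ρ * (ρ - rPlus M e) ^ ε * Real.exp (-a * (ρ - rPlus M e)) : ℝ) : ℂ) *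
      Complex.exp (Complex.I *
        ((xi0 M e η₀ * Real.log (ρ - rPlus M e) + m * φ : ℝ) : ℂ))
  else 0

/-- `C` has at `x₀ = 0` the Cauchy data of the wave packet: the value above, and the slope
`∂₀C = i β̂ C`. -/
structure HasPacketData (M e η₀ ε a : ℝ) (m : ℤ) (C : SpacetimeFun) : Prop where
  value : ∀ ρ φ : ℝ, 0 < ρ → C 0 ρ φ = packetValue M e η₀ ε a m ρ φ
  slope : ∀ ρ φ : ℝ, 0 < ρ → ρ ≠ rPlus M e →
    HasDerivAt (fun x₀ => C x₀ ρ φ)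
      (Complex.I * (beta M e η₀ ρ : ℂ) * packetValue M e η₀ ε a m ρ φ) 0

/-- `C / ⟨C, C⟩^{1/2}`. -/
def normalized (M e : ℝ) (C : SpacetimeFun) : SpacetimeFun :=
  fun x₀ ρ φ => C x₀ ρ φ / (√(kgInner M e 0 C C).re : ℂ)

/-! ### The bosonic Fock representation over the mode labels -/

/-- Sequences `(ψ_n)` of `n`-particle wave functions of the labels `k₁, …, k_n`. -/
abbrev FockVector := (n : ℕ) → (Fin n → Mode) → ℂ

/-- The vacuum `|0⟩`: `ψ_0 = 1` and `ψ_n = 0` for `n ≥ 1`. -/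
def vacuum : FockVector
  | 0, _ => 1
  | _ + 1, _ => 0

/-- `∑ ∫ conj(g(k)) α_k^+ dη_ρ`, where `(α_k^+ ψ)_n(k₁, …, k_n) = √(n+1) ψ_{n+1}(k, k₁, …, k_n)`
is the annihilation operator. -/
def annihilate (g : Mode → ℂ) (ψ : FockVector) : FockVector :=
  fun n x => (√((n : ℝ) + 1) : ℂ) *
    ∫ k, conj (g k) * ψ (n + 1) (Fin.cons k x : Fin (n + 1) → Mode) ∂modeMeasure

/-- `∑ ∫ g(k) α_{-k}^- dη_ρ`, where the creation operator `α_{-k}^-` is the adjoint of `α_k^+`: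
the value at `(k₁, …, k_n)` is `n^{-1/2} ∑_j g(k_j) ψ_{n-1}(k₁, …, k_{j-1}, k_{j+1}, …, k_n)`. -/
def create (g : Mode → ℂ) (ψ : FockVector) : FockVector
  | 0, _ => 0
  | n + 1, x => (1 / √((n : ℝ) + 1) : ℂ) *
      ∑ j : Fin (n + 1), g (x j) * ψ n (fun i => x (j.succAbove i))

/-- `⟨C, Φ⟩ = ∑ ∫ (conj(C^+(k)) α_k^+ - conj(C^-(k)) α_{-k}^-) dη_ρ`. -/
def fieldPairing (Cp Cm : Mode → ℂ) (ψ : FockVector) : FockVector :=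
  annihilate Cp ψ - create (fun k => conj (Cm k)) ψ

/-- The adjoint `⟨C, Φ⟩^* = ∑ ∫ (C^+(k) α_{-k}^- - C^-(k) α_k^+) dη_ρ`. -/
def fieldPairingAdj (Cp Cm : Mode → ℂ) (ψ : FockVector) : FockVector :=
  create Cp ψ - annihilate (fun k => conj (Cm k)) ψ

/-- The number operator `N(C) = ⟨C, Φ⟩^* ⟨C, Φ⟩`. -/
def numberOp (Cp Cm : Mode → ℂ) (ψ : FockVector) : FockVector :=
  fieldPairingAdj Cp Cm (fieldPairing Cp Cm ψ)

/-- The inner product of Fock space, `∑_n ∫ conj(φ_n) ψ_n`. -/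
def fockInner (φ ψ : FockVector) : ℂ :=
  ∑' n : ℕ, ∫ x : Fin n → Mode, conj (φ n x) * ψ n x ∂(Measure.pi fun _ => modeMeasure)

/-- `⟨0| N(C) |0⟩`, for the mode functions `fp k = f_k^+`, `fm k = f_k^-`. -/
def vacuumNumber (M e : ℝ) (fp fm : Mode → SpacetimeFun) (C : SpacetimeFun) : ℂ :=
  fockInner vacuum (numberOp (coeffPlus M e fp C) (coeffMinus M e fm C) vacuum)

/-! ### The limit -/

/-- `Γ₁`, the factor in `Γ(iξ + ε) = e^{-πξ/2} Γ₁(iξ + ε)`. -/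
def gamma1 (ε ξ : ℝ) : ℂ :=
  Complex.exp ((Real.pi / 2 * ξ : ℝ) : ℂ) * Complex.Gamma (Complex.I * (ξ : ℂ) + (ε : ℂ))

/-- `Ĉ₃(η) = ½ e^{-2πξ} |Γ₁(iξ+ε)|² |ξ+iε|² |η (η²+1)^{-1/4} + (η²+1)^{1/4}|²
e^{2ξ arg(η+i)} (η²+1)^{-ε-1}`. -/
def C3 (ε ξ η : ℝ) : ℝ :=
  1 / 2 * Real.exp (-2 * Real.pi * ξ) * ‖gamma1 ε ξ‖ ^ 2 * ‖(ξ : ℂ) + Complex.I * (ε : ℂ)‖ ^ 2 *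
    |η / (η ^ 2 + 1) ^ (1 / 4 : ℝ) + (η ^ 2 + 1) ^ (1 / 4 : ℝ)| ^ 2 *
    Real.exp (2 * ξ * Complex.arg ((η : ℂ) + Complex.I)) * (η ^ 2 + 1) ^ (-ε - 1)

/-- `I₊`, the part of the limit coming from `η_ρ > 0`. -/
def Iplus (ε ξ : ℝ) : ℝ :=
  (2 : ℝ) ^ (2 * ε) / (4 * Real.pi * Real.Gamma (2 * ε)) * ∫ η in Set.Ioi (0 : ℝ), 1 / ξ * C3 ε ξ η

/-- `I₋`, the part of the limit coming from `η_ρ < 0`. -/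
def Iminus (ε ξ : ℝ) : ℝ :=
  (2 : ℝ) ^ (2 * ε) / (4 * Real.pi * Real.Gamma (2 * ε)) * ∫ η in Set.Iio (0 : ℝ), 1 / ξ * C3 ε ξ η

end RN

end

open MeasureTheory Filter Topology
open scoped ComplexConjugate

namespace RN

/-! ### Laplace integrals -/

/-! The creation part of the field applied to the vacuum gives a one-particle state with wave
function built from `C^-`, so the expectation of `N(C)` is the squared L² norm of `C^-`
(`vacuumNumber_eq`). Everything then reduces to the Klein-Gordon product of a mode with the packet.

In that product the factors `2 - f` cancel the denominators of `β̂` and `λ₀`, the angular integral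
selects one `m'`, and with `x = ρ - r₊` the radial integral becomes a Laplace integral with `s = iξ
+ ε`, `p = a + iη` and a factor `radialFactor` (`kgInner_mode_packet`). Up to the term containing `f
= x q(x)`, that factor is affine in `x`. The affine part is evaluated exactly by `∫ x^{s-1} e^{-px}
dx = Γ(s) p^{-s}` (`integral_radialFactor`). The norm of the packet is an exact Gamma integral as
well, for every `a`.

For large `a` the packet concentrates at distance `1/a` from the horizon, where `f` is small. One
integration by parts makes this quantitative: the `f` term is at most a constant times `a^{-ε} (η² +
a²)^{-1/2}` (`norm_radialRemainder_le`). After the substitution `η = a y` the exact part, once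
rescaled, does not depend on `a`: its modulus is `modeProfile`, whose square is `C3` up to `y ↦ -y`
(`C3_eq`). The remainder is `O(1/a)` times a fixed L² function, so dominated convergence gives the
limit (`tendsto_setIntegral_sq_of_scaled`). Half-lines are invariant under `η = a y`, hence the same
argument yields `I₊` and `I₋` separately. -/

/-- The integrand `x^{s-1} e^{-px} g(x)` of a Laplace integral. -/
noncomputable def laplaceIntegrand (s p : ℂ) (g : ℝ → ℂ) (x : ℝ) : ℂ :=
  (x : ℂ) ^ (s - 1) * Complex.exp (-p * x) * g x

lemma norm_laplaceIntegrand (s p : ℂ) (g : ℝ → ℂ) {x : ℝ} (hx : 0 < x) :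
    ‖laplaceIntegrand s p g x‖ = x ^ (s.re - 1) * Real.exp (-(p.re * x)) * ‖g x‖ := by
  rw [laplaceIntegrand, norm_mul, norm_mul, Complex.norm_cpow_eq_rpow_re_of_pos hx, Complex.norm_exp]
  simp

lemma integrableOn_rpow_mul_exp {σ b : ℝ} (hσ : 0 < σ) (hb : 0 < b) :
    IntegrableOn (fun x : ℝ => x ^ (σ - 1) * Real.exp (-(b * x))) (Set.Ioi 0) := by
  have := integrableOn_rpow_mul_exp_neg_mul_rpow (p := 1) (s := σ - 1) (b := b)
    (by linarith) one_pos hb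
  simpa using this

/-- The majorant `x^{σ-1} e^{-bx} (A + B x)`. -/
noncomputable def laplaceMajorant (σ b A B x : ℝ) : ℝ :=
  x ^ (σ - 1) * Real.exp (-(b * x)) * (A + B * x)

lemma laplaceMajorant_eq {σ b A B x : ℝ} (hx : 0 < x) : laplaceMajorant σ b A B x =
    A * (x ^ (σ - 1) * Real.exp (-(b * x))) + B * (x ^ (σ + 1 - 1) * Real.exp (-(b * x))) := by
  have : x ^ (σ + 1 - 1) = x ^ (σ - 1) * x := by
    rw [show σ + 1 - 1 = σ - 1 + 1 by ring, Real.rpow_add_one hx.ne']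
  rw [laplaceMajorant, this]; ring

lemma integrableOn_laplaceMajorant {σ b : ℝ} (hσ : 0 < σ) (hb : 0 < b) (A B : ℝ) :
    IntegrableOn (laplaceMajorant σ b A B) (Set.Ioi 0) :=
  IntegrableOn.congr_fun (((integrableOn_rpow_mul_exp hσ hb).const_mul A).add
    ((integrableOn_rpow_mul_exp (add_pos hσ one_pos) hb).const_mul B))
    (fun _ hx => (laplaceMajorant_eq hx).symm) measurableSet_Ioi

lemma integral_laplaceMajorant {σ b : ℝ} (hσ : 0 < σ) (hb : 0 < b) (A B : ℝ) :
    ∫ x in Set.Ioi 0, laplaceMajorant σ b A B x =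
      (1 / b) ^ σ * (A * Real.Gamma σ + B / b * Real.Gamma (σ + 1)) := by
  rw [setIntegral_congr_fun measurableSet_Ioi (fun _ hx => laplaceMajorant_eq hx),
    integral_add ((integrableOn_rpow_mul_exp hσ hb).const_mul A)
      ((integrableOn_rpow_mul_exp (add_pos hσ one_pos) hb).const_mul B),
    integral_const_mul, integral_const_mul, Real.integral_rpow_mul_exp_neg_mul_Ioi hσ hb,
    Real.integral_rpow_mul_exp_neg_mul_Ioi (add_pos hσ one_pos) hb,
    Real.rpow_add_one (by positivity)]
  ring

lemma norm_laplaceIntegrand_le {s p : ℂ} {g : ℝ → ℂ} {A B x : ℝ} (hx : 0 < x)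
    (hg : ‖g x‖ ≤ A + B * x) :
    ‖laplaceIntegrand s p g x‖ ≤ laplaceMajorant s.re p.re A B x := by
  rw [norm_laplaceIntegrand s p g hx, laplaceMajorant]
  gcongr

lemma continuousOn_laplaceIntegrand {s p : ℂ} {g : ℝ → ℂ} (hg : ContinuousOn g (Set.Ioi 0)) :
    ContinuousOn (laplaceIntegrand s p g) (Set.Ioi 0) := by
  refine ContinuousOn.mul (ContinuousOn.mul ?_ (by fun_prop)) hg
  intro x hx
  exact (Complex.continuousAt_ofReal_cpow_const x (s - 1)
    (Or.inr (ne_of_gt hx))).continuousWithinAt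

lemma integrableOn_laplaceIntegrand {s p : ℂ} {g : ℝ → ℂ} {A B : ℝ} (hs : 0 < s.re) (hp : 0 < p.re)
    (hg : ContinuousOn g (Set.Ioi 0)) (hb : ∀ x, 0 < x → ‖g x‖ ≤ A + B * x) :
    IntegrableOn (laplaceIntegrand s p g) (Set.Ioi 0) := by
  refine (integrableOn_laplaceMajorant hs hp A B).mono'
    ((continuousOn_laplaceIntegrand hg).aestronglyMeasurable measurableSet_Ioi) ?_
  filter_upwards [ae_restrict_mem measurableSet_Ioi] with x hx
  exact norm_laplaceIntegrand_le hx (hb x hx)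

lemma norm_integral_laplaceIntegrand_le {s p : ℂ} {g : ℝ → ℂ} {A B : ℝ} (hs : 0 < s.re)
    (hp : 0 < p.re) (hb : ∀ x, 0 < x → ‖g x‖ ≤ A + B * x) :
    ‖∫ x in Set.Ioi 0, laplaceIntegrand s p g x‖ ≤
      (1 / p.re) ^ s.re * (A * Real.Gamma s.re + B / p.re * Real.Gamma (s.re + 1)) := by
  rw [← integral_laplaceMajorant hs hp]
  refine norm_integral_le_of_norm_le (integrableOn_laplaceMajorant hs hp A B) ?_
  filter_upwards [ae_restrict_mem measurableSet_Ioi] with x hx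
  exact norm_laplaceIntegrand_le hx (hb x hx)

/-- The exponent is raised by one so that the primitive vanishes at `0`; differentiating `x^s v`
then leaves `x^{s-1}` times the scale-invariant combination `s v + x v'`. -/
lemma hasDerivAt_laplaceIntegrand_add_one {s p : ℂ} {v v' : ℝ → ℂ} (hs : 0 < s.re) {x : ℝ}
    (hx : 0 < x) (hv : HasDerivAt v (v' x) x) :
    HasDerivAt (laplaceIntegrand (s + 1) p v)
      (laplaceIntegrand s p (fun x => s * v x + x * v' x) x - p * laplaceIntegrand (s + 1) p v x)
      x := by
  have hs0 : s ≠ 0 := fun h => by simp [h] at hs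
  have h1 : HasDerivAt (fun x : ℝ => (x : ℂ) ^ (s + 1 - 1)) (s * (x : ℂ) ^ (s - 1)) x := by
    simpa using hasDerivAt_ofReal_cpow_const hx.ne' hs0
  have h2 : HasDerivAt (fun x : ℝ => Complex.exp (-p * x)) (Complex.exp (-p * x) * (-p * 1)) x :=
    ((Complex.ofRealCLM.hasDerivAt (x := x)).const_mul (-p)).cexp
  convert! (h1.mul h2).mul hv using 1
  have h3 : (x : ℂ) ^ (s + 1 - 1) = (x : ℂ) ^ (s - 1) * x := by
    rw [add_sub_right_comm, Complex.cpow_add _ _ (by exact_mod_cast hx.ne'), Complex.cpow_one]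
  simp only [laplaceIntegrand, h3, Pi.mul_apply]
  ring

/-- Integration by parts in a Laplace integral. -/
lemma mul_integral_laplaceIntegrand {s p : ℂ} {v v' : ℝ → ℂ} {A B : ℝ} (hs : 0 < s.re)
    (hp : 0 < p.re) (hv : ∀ x, 0 < x → HasDerivAt v (v' x) x)
    (hv' : ContinuousOn v' (Set.Ioi 0)) (hb : ∀ x, 0 < x → ‖v x‖ ≤ A + B * x)
    (hb' : ∀ x, 0 < x → ‖s * v x + x * v' x‖ ≤ A + B * x) :
    p * ∫ x in Set.Ioi 0, laplaceIntegrand (s + 1) p v x =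
      ∫ x in Set.Ioi 0, laplaceIntegrand s p (fun x => s * v x + x * v' x) x := by
  have hvc : ContinuousOn v (Set.Ioi 0) := fun x hx => (hv x hx).continuousAt.continuousWithinAt
  have hs1 : 0 < (s + 1).re := by simp; linarith
  have i1 := integrableOn_laplaceIntegrand hs1 hp hvc hb
  have i2 : IntegrableOn (laplaceIntegrand s p (fun x => s * v x + x * v' x)) (Set.Ioi 0) :=
    integrableOn_laplaceIntegrand hs hp (by fun_prop) hb'
  have hle : ∀ x : ℝ, 0 < x → ‖laplaceIntegrand (s + 1) p v x‖ ≤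
      laplaceMajorant (s.re + 1) p.re A B x := fun x hx => by
    simpa using norm_laplaceIntegrand_le (s := s + 1) (p := p) hx (hb x hx)
  have hz : laplaceIntegrand (s + 1) p v 0 = 0 := by
    have hs0 : s ≠ 0 := fun h => by simp [h] at hs
    simp [laplaceIntegrand, hs0]
  -- Both boundary terms vanish: the majorant carries the power `x^{Re s}` with `Re s > 0` at the
  -- origin and decays exponentially at infinity.
  have h0 : ContinuousWithinAt (laplaceIntegrand (s + 1) p v) (Set.Ici 0) 0 := by
    rw [← Set.Ioi_insert, continuousWithinAt_insert_self, ContinuousWithinAt, hz]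
    refine squeeze_zero_norm' (a := laplaceMajorant (s.re + 1) p.re A B) ?_ ?_
    · filter_upwards [self_mem_nhdsWithin] with x hx using hle x hx
    · refine tendsto_nhdsWithin_of_tendsto_nhds ?_
      have : ContinuousAt (laplaceMajorant (s.re + 1) p.re A B) 0 := by
        unfold laplaceMajorant
        refine ContinuousAt.mul (ContinuousAt.mul ?_ (by fun_prop)) (by fun_prop)
        exact Real.continuousAt_rpow_const _ _ (Or.inr (by linarith))
      have h := this.tendsto
      rwa [show laplaceMajorant (s.re + 1) p.re A B 0 = 0 by
        simp [laplaceMajorant, hs.ne']] at h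
  have hinf : Tendsto (laplaceIntegrand (s + 1) p v) atTop (𝓝 0) := by
    refine squeeze_zero_norm' (a := laplaceMajorant (s.re + 1) p.re A B) ?_ ?_
    · filter_upwards [eventually_gt_atTop 0] with x hx using hle x hx
    · have t1 := (tendsto_rpow_mul_exp_neg_mul_atTop_nhds_zero (s.re + 1 - 1) p.re hp).const_mul A
      have t2 := (tendsto_rpow_mul_exp_neg_mul_atTop_nhds_zero
        (s.re + 1 + 1 - 1) p.re hp).const_mul B
      have t3 := t1.add t2
      simp only [mul_zero, add_zero] at t3
      refine t3.congr' ?_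
      filter_upwards [eventually_gt_atTop 0] with x hx
      rw [laplaceMajorant_eq hx]
      simp only [neg_mul]
  have key := integral_Ioi_of_hasDerivAt_of_tendsto h0
    (fun x hx => hasDerivAt_laplaceIntegrand_add_one hs hx (hv x hx))
    (i2.sub (i1.const_mul p)) hinf
  rw [integral_sub i2 (i1.const_mul p), integral_const_mul, hz, sub_zero] at key
  exact (sub_eq_zero.mp key).symm

lemma mul_integral_laplaceIntegrand_one {s p : ℂ} (hs : 0 < s.re) (hp : 0 < p.re) :
    p * ∫ x in Set.Ioi 0, laplaceIntegrand (s + 1) p 1 x =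
      s * ∫ x in Set.Ioi 0, laplaceIntegrand s p 1 x := by
  have h := mul_integral_laplaceIntegrand (v := 1) (v' := 0) (A := 1 + ‖s‖) (B := 0) hs hp
    (fun x _ => hasDerivAt_const x 1) continuousOn_const (fun x _ => by simp)
    (fun x _ => by simp)
  rw [h, ← integral_const_mul]
  congr 1 with x
  simp [laplaceIntegrand]; ring

lemma integrableOn_laplaceIntegrand_one {s p : ℂ} (hs : 0 < s.re) (hp : 0 < p.re) :
    IntegrableOn (laplaceIntegrand s p 1) (Set.Ioi 0) :=
  integrableOn_laplaceIntegrand (A := 1) (B := 0) hs hp continuousOn_const (fun x _ => by simp)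

/-- Differentiating `e^{-(a+iη)x}` produces `-ix`, which shifts `s` to `s + 1`. Domination is
uniform in `η` because the modulus of the exponential depends only on `a`. -/
lemma hasDerivAt_integral_laplaceIntegrand {s : ℂ} (hs : 0 < s.re) {a : ℝ} (ha : 0 < a) (η : ℝ) :
    HasDerivAt (fun η : ℝ => ∫ x in Set.Ioi 0, laplaceIntegrand s (a + Complex.I * η) 1 x)
      (-Complex.I * ∫ x in Set.Ioi 0, laplaceIntegrand (s + 1) (a + Complex.I * η) 1 x) η := by
  have hre : ∀ η : ℝ, (a + Complex.I * η : ℂ).re = a := fun η => by simp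
  rw [← integral_const_mul]
  refine (hasDerivAt_integral_of_dominated_loc_of_deriv_le (μ := volume.restrict (Set.Ioi 0))
    (F := fun (η : ℝ) x => laplaceIntegrand s (a + Complex.I * η) 1 x)
    (F' := fun (η : ℝ) x => -Complex.I * laplaceIntegrand (s + 1) (a + Complex.I * η) 1 x)
    (bound := laplaceMajorant (s.re + 1) a 1 0)
    univ_mem ?_ ?_ ?_ ?_ ?_ ?_).2
  · exact Eventually.of_forall fun η => (continuousOn_laplaceIntegrand
      continuousOn_const).aestronglyMeasurable measurableSet_Ioi
  · exact integrableOn_laplaceIntegrand_one hs (by rw [hre]; exact ha)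
  · exact ((continuousOn_laplaceIntegrand
      continuousOn_const).aestronglyMeasurable measurableSet_Ioi).const_mul _
  · filter_upwards [ae_restrict_mem measurableSet_Ioi] with x hx η _
    have := norm_laplaceIntegrand_le (s := s + 1) (p := a + Complex.I * η) (g := 1)
      (A := 1) (B := 0) hx (by simp)
    rw [hre, Complex.add_re, Complex.one_re] at this
    simpa using this
  · exact integrableOn_laplaceMajorant (by linarith) ha 1 0
  · filter_upwards [ae_restrict_mem measurableSet_Ioi] with x hx η _
    have h1 : HasDerivAt (fun η : ℝ => -(a + Complex.I * η : ℂ) * x)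
        (-(Complex.I * 1) * x) η :=
      ((((Complex.ofRealCLM.hasDerivAt (x := η)).const_mul Complex.I).const_add (a : ℂ)).neg).mul_const
        (x : ℂ)
    convert! ((h1.cexp.const_mul ((x : ℂ) ^ (s - 1))).mul_const (1 : ℂ)) using 1
    have h3 : (x : ℂ) ^ (s + 1 - 1) = (x : ℂ) ^ (s - 1) * x := by
      rw [add_sub_right_comm, Complex.cpow_add _ _ (by exact_mod_cast (ne_of_gt hx)),
        Complex.cpow_one]
    simp only [laplaceIntegrand, h3, Pi.one_apply]
    ring

/-- The Gamma integral `∫ x^{s-1} e^{-px} dx = Γ(s) p^{-s}` for complex `p`. -/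
lemma integral_laplaceIntegrand_one {s : ℂ} (hs : 0 < s.re) {a : ℝ} (ha : 0 < a) (η : ℝ) :
    ∫ x in Set.Ioi 0, laplaceIntegrand s (a + Complex.I * η) 1 x =
      Complex.Gamma s * (a + Complex.I * η) ^ (-s) := by
  have hre : ∀ η : ℝ, (a + Complex.I * η : ℂ).re = a := fun η => by simp
  have hslit : ∀ η : ℝ, (a + Complex.I * η : ℂ) ∈ Complex.slitPlane := fun η =>
    Or.inl (by rw [hre]; exact ha)
  have hne : ∀ η : ℝ, (a + Complex.I * η : ℂ) ≠ 0 := fun η => Complex.slitPlane_ne_zero (hslit η)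
  -- The relation `p L(s+1) = s L(s)` makes the derivative of `p^s L(s)` in `η` vanish, so the value
  -- may be read off at real `p = a`.
  set G := fun η : ℝ => (∫ x in Set.Ioi 0, laplaceIntegrand s (a + Complex.I * η) 1 x) *
    (a + Complex.I * η : ℂ) ^ s with hG
  have hd : ∀ η, HasDerivAt G 0 η := fun η => by
    have h1 : HasDerivAt (fun η : ℝ => (a + Complex.I * η : ℂ)) (Complex.I * 1) η :=
      ((Complex.ofRealCLM.hasDerivAt (x := η)).const_mul Complex.I).const_add (a : ℂ)
    have h2 := (Complex.hasStrictDerivAt_cpow_const (c := s) (hslit η)).hasDerivAt.comp η h1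
    convert! (hasDerivAt_integral_laplaceIntegrand hs ha η).mul h2 using 1
    have h3 := mul_integral_laplaceIntegrand_one hs (p := a + Complex.I * η) (by rw [hre]; exact ha)
    have h4 : (a + Complex.I * η : ℂ) ^ s =
        (a + Complex.I * η : ℂ) ^ (s - 1) * (a + Complex.I * η) := by
      rw [Complex.cpow_sub _ _ (hne η), Complex.cpow_one, div_mul_cancel₀ _ (hne η)]
    simp only [Function.comp_apply, h4]
    linear_combination (Complex.I * (a + Complex.I * η : ℂ) ^ (s - 1)) * h3
  have hconst : G η = G 0 := is_const_of_deriv_eq_zero (fun η => (hd η).differentiableAt)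
    (fun η => (hd η).deriv) η 0
  have h0 : G 0 = Complex.Gamma s := by
    have h := Complex.integral_cpow_mul_exp_neg_mul_Ioi hs ha
    simp only [hG, laplaceIntegrand, Complex.ofReal_zero, mul_zero, add_zero, Pi.one_apply, mul_one,
      neg_mul]
    rw [h, one_div, Complex.inv_cpow _ _ (by rw [Complex.arg_ofReal_of_nonneg ha.le]; exact
      Real.pi_pos.ne)]
    rw [mul_comm, ← mul_assoc, mul_inv_cancel₀, one_mul]
    simpa [Complex.cpow_eq_zero_iff] using fun h => absurd h ha.ne'
  rw [Complex.cpow_neg, ← div_eq_mul_inv, eq_div_iff]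
  · rw [← h0, ← hconst]
  · simpa [Complex.cpow_eq_zero_iff] using fun h => absurd h (hne η)

/-! ### The exterior region -/

lemma rMinus_nonneg {M e : ℝ} (hM : 0 < M) : 0 ≤ rMinus M e := by
  rw [rMinus, sub_nonneg, Real.sqrt_le_left hM.le]
  nlinarith [sq_nonneg e]

lemma rMinus_lt_rPlus {M e : ℝ} (he : e ^ 2 < M ^ 2) : rMinus M e < rPlus M e := by
  have := Real.sqrt_pos.mpr (sub_pos.mpr he)
  rw [rMinus, rPlus]; linarith

lemma rPlus_pos {M e : ℝ} (hM : 0 < M) : 0 < rPlus M e := by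
  have := Real.sqrt_nonneg (M ^ 2 - e ^ 2)
  rw [rPlus]; linarith

lemma f_eq {M e ρ : ℝ} (he : e ^ 2 < M ^ 2) (hρ : ρ ≠ 0) :
    f M e ρ = (ρ - rPlus M e) * (ρ - rMinus M e) / ρ ^ 2 := by
  have := Real.sq_sqrt (sub_pos.mpr he).le
  rw [f, rPlus, rMinus]
  field_simp
  linear_combination this

/-- Outside the horizon `0 < ρ - r₊ < ρ` and `0 < ρ - r₋ ≤ ρ`. This keeps `2 - f`, the denominator
of `β̂` and `λ₀`, away from zero. -/
lemma f_lt_one {M e ρ : ℝ} (hM : 0 < M) (he : e ^ 2 < M ^ 2) (hρ : rPlus M e < ρ) :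
    f M e ρ < 1 := by
  have h0 := rPlus_pos (e := e) hM
  have h1 := rMinus_nonneg (e := e) hM
  have h2 := rMinus_lt_rPlus he
  rw [f_eq he (by linarith), div_lt_one (by nlinarith)]
  nlinarith

lemma xi0_pos {M e η₀ : ℝ} (hM : 0 < M) (he : e ^ 2 < M ^ 2) (hη₀ : 0 < η₀) : 0 < xi0 M e η₀ := by
  have h0 := rPlus_pos (e := e) hM
  have h2 := sub_pos.mpr (rMinus_lt_rPlus he)
  rw [xi0]; positivity

/-- The factor `q` in `f(r₊ + x) = x q(x)`. -/
noncomputable def fQuot (M e x : ℝ) : ℝ := (x + (rPlus M e - rMinus M e)) / (x + rPlus M e) ^ 2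

lemma f_eq_mul_fQuot {M e ρ : ℝ} (he : e ^ 2 < M ^ 2) (hρ : ρ ≠ 0) :
    f M e ρ = (ρ - rPlus M e) * fQuot M e (ρ - rPlus M e) := by
  rw [f_eq he hρ, fQuot, sub_add_cancel]; ring

/-! ### Derivatives of the Cauchy data -/

lemma hasDerivAt_inv_sqrt {ρ : ℝ} (hρ : 0 < ρ) :
    HasDerivAt (fun r : ℝ => 1 / √r) (-(1 / (2 * ρ)) * (1 / √ρ)) ρ := by
  have h := ((Real.hasDerivAt_sqrt hρ.ne').inv (Real.sqrt_pos.mpr hρ).ne')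
  simp only [one_div]
  convert! h using 1
  rw [Real.sq_sqrt hρ.le]
  field_simp

/-- Written as a logarithmic derivative, so that the mode factors out of the Klein-Gordon integrand;
the same form is used for the packet, and the two `-1/(2ρ)` terms cancel there. -/
lemma hasDerivAt_modeValue (a : ℝ) (k : Mode) (φ : ℝ) {ρ : ℝ} (hρ : 0 < ρ) :
    HasDerivAt (fun r => modeValue a k r φ)
      ((((-(1 / (2 * ρ)) : ℝ) : ℂ) + Complex.I * k.1) * modeValue a k ρ φ) ρ := by
  have hg : HasDerivAt (fun r => gammaK a k r) (-(1 / (2 * ρ)) * gammaK a k ρ) ρ := by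
    have h := (hasDerivAt_inv_sqrt hρ).mul_const
      (1 / (k.1 ^ 2 + a ^ 2) ^ (1 / 4 : ℝ) * (1 / (√2 * (2 * Real.pi))))
    convert! h using 1
    · ext r; simp only [gammaK, one_div, mul_inv]; ring
    · simp only [gammaK, one_div, mul_inv]; ring
  have he : HasDerivAt (fun r : ℝ => Complex.I * ((r * k.1 + k.2 * φ : ℝ) : ℂ))
      (Complex.I * ((1 * k.1 : ℝ) : ℂ)) ρ :=
    ((((hasDerivAt_id ρ).mul_const k.1).add_const ((k.2 : ℝ) * φ)).ofReal_comp).const_mul Complex.I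
  convert! hg.ofReal_comp.mul he.cexp using 1
  simp only [modeValue, one_mul, Complex.ofReal_mul]
  ring

lemma hasDerivAt_packetValue (M e η₀ ε a : ℝ) (m : ℤ) (φ : ℝ) {ρ : ℝ} (h0 : 0 < ρ)
    (hρ : rPlus M e < ρ) :
    HasDerivAt (fun r => packetValue M e η₀ ε a m r φ)
      ((((ε / (ρ - rPlus M e) - a - 1 / (2 * ρ) : ℝ) : ℂ) +
        Complex.I * ((xi0 M e η₀ / (ρ - rPlus M e) : ℝ) : ℂ)) * packetValue M e η₀ ε a m ρ φ) ρ := by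
  have hx : 0 < ρ - rPlus M e := sub_pos.mpr hρ
  have hid : HasDerivAt (fun r : ℝ => r - rPlus M e) 1 ρ := (hasDerivAt_id ρ).sub_const _
  have hpow : HasDerivAt (fun r : ℝ => (r - rPlus M e) ^ ε)
      (ε / (ρ - rPlus M e) * (ρ - rPlus M e) ^ ε) ρ := by
    convert! hid.rpow_const (p := ε) (Or.inl hx.ne') using 1
    rw [Real.rpow_sub_one hx.ne']; ring
  have hexp : HasDerivAt (fun r : ℝ => Real.exp (-a * (r - rPlus M e)))
      (-a * Real.exp (-a * (ρ - rPlus M e))) ρ := by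
    convert! (hid.const_mul (-a)).exp using 1
    ring
  have hphase : HasDerivAt (fun r : ℝ => Complex.I *
      ((xi0 M e η₀ * Real.log (r - rPlus M e) + m * φ : ℝ) : ℂ))
      (Complex.I * ((xi0 M e η₀ * (1 / (ρ - rPlus M e)) : ℝ) : ℂ)) ρ :=
    ((((hid.log hx.ne').const_mul (xi0 M e η₀)).add_const ((m : ℝ) * φ)).ofReal_comp).const_mul
      Complex.I
  have hmain := (((hasDerivAt_inv_sqrt h0).mul hpow).mul hexp).ofReal_comp.mul hphase.cexp
  refine (hmain.congr_of_eventuallyEq (f₁ := fun r => packetValue M e η₀ ε a m r φ)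
    ?_).congr_deriv ?_
  · filter_upwards [lt_mem_nhds hρ] with r hr
    simp only [packetValue, if_pos hr]
    rfl
  · simp only [packetValue, if_pos hρ, Pi.mul_apply]
    push_cast
    ring

lemma packetValue_of_le {M e η₀ ε a : ℝ} {m : ℤ} {ρ φ : ℝ} (h : ρ ≤ rPlus M e) :
    packetValue M e η₀ ε a m ρ φ = 0 := if_neg h.not_gt

lemma HasModeData.dRho_eq {M e a σ : ℝ} {k : Mode} {F : SpacetimeFun}
    (hF : HasModeData M e a σ k F) {ρ : ℝ} (hρ : 0 < ρ) (φ : ℝ) :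
    dRho F 0 ρ φ =
      (((-(1 / (2 * ρ)) : ℝ) : ℂ) + Complex.I * k.1) * modeValue a k ρ φ := by
  rw [dRho, ← (hasDerivAt_modeValue a k φ hρ).deriv]
  refine EventuallyEq.deriv_eq ?_
  filter_upwards [lt_mem_nhds hρ] with r hr using hF.value r φ hr

lemma HasPacketData.dRho_eq {M e η₀ ε a : ℝ} {m : ℤ} {C : SpacetimeFun} (hM : 0 < M)
    (hC : HasPacketData M e η₀ ε a m C) {ρ : ℝ} (hρ : rPlus M e < ρ) (φ : ℝ) :
    dRho C 0 ρ φ = (((ε / (ρ - rPlus M e) - a - 1 / (2 * ρ) : ℝ) : ℂ) +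
        Complex.I * ((xi0 M e η₀ / (ρ - rPlus M e) : ℝ) : ℂ)) *
          packetValue M e η₀ ε a m ρ φ := by
  have h0 : 0 < ρ := (rPlus_pos hM).trans hρ
  rw [dRho, ← (hasDerivAt_packetValue M e η₀ ε a m φ h0 hρ).deriv]
  refine EventuallyEq.deriv_eq ?_
  filter_upwards [lt_mem_nhds h0] with r hr using hC.value r φ hr

lemma HasPacketData.dRho_eq_zero {M e η₀ ε a : ℝ} {m : ℤ} {C : SpacetimeFun}
    (hC : HasPacketData M e η₀ ε a m C) {ρ : ℝ} (h0 : 0 < ρ) (hρ : ρ < rPlus M e) (φ : ℝ) :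
    dRho C 0 ρ φ = 0 := by
  rw [dRho, ← deriv_const ρ (0 : ℂ)]
  refine EventuallyEq.deriv_eq ?_
  filter_upwards [lt_mem_nhds h0, gt_mem_nhds hρ] with r hr hr'
  rw [hC.value r φ hr, packetValue_of_le hr'.le]

lemma HasPacketData.dTime_eq {M e η₀ ε a : ℝ} {m : ℤ} {C : SpacetimeFun}
    (hC : HasPacketData M e η₀ ε a m C) {ρ : ℝ} (h0 : 0 < ρ) (hρ : ρ ≠ rPlus M e) (φ : ℝ) :
    dTime C 0 ρ φ = Complex.I * (beta M e η₀ ρ : ℂ) * packetValue M e η₀ ε a m ρ φ :=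
  (hC.slope ρ φ h0 hρ).deriv

lemma HasModeData.dTime_eq {M e a σ : ℝ} {k : Mode} {F : SpacetimeFun} (hM : 0 < M)
    (he : e ^ 2 < M ^ 2) (hF : HasModeData M e a σ k F) {ρ : ℝ} (hρ : rPlus M e < ρ) (φ : ℝ) :
    dTime F 0 ρ φ = Complex.I * (lambda0 M e a σ k ρ : ℂ) * modeValue a k ρ φ :=
  (hF.slope ρ φ ((rPlus_pos hM).trans hρ) (by linarith [f_lt_one hM he hρ])).deriv

/-! ### The Klein-Gordon product with the packet -/

/-- The integrand of `kgInner` on the slice `x₀ = 0`. -/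
noncomputable def kgIntegrand (M e : ℝ) (u v : SpacetimeFun) (ρ φ : ℝ) : ℂ :=
    (((2 - f M e ρ : ℝ) : ℂ) *
        (conj (u 0 ρ φ) * dTime v 0 ρ φ - conj (dTime u 0 ρ φ) * v 0 ρ φ)
      + ((f M e ρ - 1 : ℝ) : ℂ) *
        (conj (u 0 ρ φ) * dRho v 0 ρ φ - conj (dRho u 0 ρ φ) * v 0 ρ φ)) * (ρ : ℂ)

lemma kgInner_eq (M e : ℝ) (u v : SpacetimeFun) : kgInner M e 0 u v =
    Complex.I * ∫ ρ in Set.Ioi (0 : ℝ), ∫ φ in (0 : ℝ)..(2 * Real.pi), kgIntegrand M e u v ρ φ :=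
  rfl

lemma HasPacketData.kgIntegrand_eq_zero {M e η₀ ε a : ℝ} {m : ℤ} {C : SpacetimeFun}
    (hC : HasPacketData M e η₀ ε a m C) (u : SpacetimeFun) {ρ : ℝ} (h0 : 0 < ρ)
    (hρ : ρ < rPlus M e) (φ : ℝ) : kgIntegrand M e u C ρ φ = 0 := by
  rw [kgIntegrand, hC.dRho_eq_zero h0 hρ, hC.dTime_eq h0 hρ.ne, hC.value ρ φ h0,
    packetValue_of_le hρ.le]
  simp

/-- Below the horizon the packet contributes nothing, and the sphere `ρ = r₊`, where its data need
not be differentiable, is a null set. -/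
lemma HasPacketData.kgInner_eq_mul {M e η₀ ε a : ℝ} {m : ℤ} {C : SpacetimeFun} (hM : 0 < M)
    (hC : HasPacketData M e η₀ ε a m C) (u : SpacetimeFun) {A E : ℝ → ℂ}
    (h : ∀ ρ φ, rPlus M e < ρ → kgIntegrand M e u C ρ φ = A (ρ - rPlus M e) * E φ) :
    kgInner M e 0 u C =
      Complex.I * ((∫ x in Set.Ioi 0, A x) * ∫ φ in (0 : ℝ)..(2 * Real.pi), E φ) := by
  have h0 := rPlus_pos (e := e) hM
  have hsub : Set.Ioi (rPlus M e) ⊆ Set.Ioi 0 := Set.Ioi_subset_Ioi h0.le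
  rw [kgInner_eq, setIntegral_eq_of_subset_of_ae_sdiff_eq_zero
    measurableSet_Ioi.nullMeasurableSet hsub ?_]
  · rw [setIntegral_congr_fun measurableSet_Ioi (g := fun ρ =>
      A (ρ - rPlus M e) * ∫ φ in (0 : ℝ)..(2 * Real.pi), E φ)
      (fun ρ hρ => by simp only [h ρ _ hρ, intervalIntegral.integral_const_mul]),
      integral_mul_const]
    congr 2
    rw [← integral_indicator measurableSet_Ioi, ← integral_indicator measurableSet_Ioi,
      ← integral_add_right_eq_self _ (rPlus M e)]
    congr 1 with ρ
    simp [Set.indicator]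
  · have hne : ∀ᵐ ρ : ℝ, ρ ≠ rPlus M e := by
      simp [ae_iff]
    filter_upwards [hne] with ρ hρ hmem
    have hlt : ρ < rPlus M e := lt_of_le_of_ne (not_lt.mp hmem.2) hρ
    simp only [hC.kgIntegrand_eq_zero u hmem.1 hlt, intervalIntegral.integral_zero]

/-- The measure factor `ρ` cancels the two factors `1/√ρ`; expanding around `r₊` leaves a Laplace
kernel, an angular exponential and a constant phase. -/
lemma conj_modeValue_mul_packetValue {M e η₀ ε a : ℝ} (m : ℤ) (k : Mode) {ρ : ℝ} (h0 : 0 < ρ)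
    (hρ : rPlus M e < ρ) (φ : ℝ) :
    conj (modeValue a k ρ φ) * packetValue M e η₀ ε a m ρ φ * ρ =
      ((1 / (k.1 ^ 2 + a ^ 2) ^ (1 / 4 : ℝ) * (1 / (√2 * (2 * Real.pi))) : ℝ) : ℂ) *
      Complex.exp (-(Complex.I * k.1 * rPlus M e)) *
      (((ρ - rPlus M e : ℝ) : ℂ) ^ (Complex.I * (xi0 M e η₀ : ℂ) + ε) *
        Complex.exp (-(a + Complex.I * k.1) * ((ρ - rPlus M e : ℝ) : ℂ))) *
      Complex.exp (Complex.I * ((m - k.2 : ℤ) : ℂ) * φ) := by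
  have hx : 0 < ρ - rPlus M e := sub_pos.mpr hρ
  have hpow : ((ρ - rPlus M e : ℝ) : ℂ) ^ (Complex.I * (xi0 M e η₀ : ℂ) + ε) =
      (((ρ - rPlus M e) ^ ε : ℝ) : ℂ) *
        Complex.exp (Complex.I * (xi0 M e η₀ * Real.log (ρ - rPlus M e) : ℝ)) := by
    rw [Complex.cpow_add _ _ (by exact_mod_cast hx.ne'), Complex.ofReal_cpow hx.le,
      Complex.cpow_def_of_ne_zero (by exact_mod_cast hx.ne'), ← Complex.ofReal_log hx.le]
    push_cast
    ring_nf
  have hsq : (1 / √ρ) * (1 / √ρ) * ρ = 1 := by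
    rw [div_mul_div_comm, Real.mul_self_sqrt h0.le, one_mul, one_div, inv_mul_cancel₀ h0.ne']
  have hsqC : (((1 / √ρ : ℝ) : ℂ)) * ((1 / √ρ : ℝ) : ℂ) * ρ = 1 := by exact_mod_cast hsq
  have hgam : gammaK a k ρ =
      (1 / √ρ) * (1 / (k.1 ^ 2 + a ^ 2) ^ (1 / 4 : ℝ) * (1 / (√2 * (2 * Real.pi)))) := by
    simp only [gammaK, one_div, mul_inv]; ring
  have hexp : Complex.exp (-(Complex.I * ((ρ * k.1 + k.2 * φ : ℝ) : ℂ))) *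
      (Complex.exp ((-a * (ρ - rPlus M e) : ℝ) : ℂ) *
        Complex.exp (Complex.I *
        ((xi0 M e η₀ * Real.log (ρ - rPlus M e) + m * φ : ℝ) : ℂ))) =
      Complex.exp (-(Complex.I * k.1 * rPlus M e)) *
      Complex.exp (Complex.I * (xi0 M e η₀ * Real.log (ρ - rPlus M e) : ℝ)) *
      Complex.exp (-(a + Complex.I * k.1) * ((ρ - rPlus M e : ℝ) : ℂ)) *
      Complex.exp (Complex.I * ((m - k.2 : ℤ) : ℂ) * φ) := by
    simp only [← Complex.exp_add]
    congr 1
    push_cast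
    ring
  rw [packetValue, if_pos hρ, modeValue, hpow, hgam, map_mul, ← Complex.exp_conj, Complex.conj_ofReal,
    map_mul, Complex.conj_I, Complex.conj_ofReal, neg_mul, Complex.ofReal_mul (1 / √ρ),
    Complex.ofReal_mul (_ * _) (Real.exp _), Complex.ofReal_mul (1 / √ρ) (_ ^ _), Complex.ofReal_exp]
  generalize ((1 / √ρ : ℝ) : ℂ) = S at *
  generalize (((ρ - rPlus M e) ^ ε : ℝ) : ℂ) = P at *
  generalize ((1 / (k.1 ^ 2 + a ^ 2) ^ (1 / 4 : ℝ) * (1 / (√2 * (2 * Real.pi))) : ℝ) : ℂ) = G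
  linear_combination (G * P * S * S * ρ) * hexp + (G * P *
      Complex.exp (-(Complex.I * k.1 * rPlus M e)) *
      Complex.exp (Complex.I * (xi0 M e η₀ * Real.log (ρ - rPlus M e) : ℝ)) *
      Complex.exp (-(a + Complex.I * k.1) * ((ρ - rPlus M e : ℝ) : ℂ)) *
      Complex.exp (Complex.I * ((m - k.2 : ℤ) : ℂ) * φ)) * hsqC

lemma integral_exp_int_mul (n : ℤ) : ∫ φ in (0 : ℝ)..(2 * Real.pi),
    Complex.exp (Complex.I * (n : ℂ) * φ) = if n = 0 then 2 * Real.pi else 0 := by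
  split_ifs with h
  · simp [h]
  · have hn : Complex.I * (n : ℂ) ≠ 0 := mul_ne_zero Complex.I_ne_zero (by exact_mod_cast h)
    rw [integral_exp_mul_complex hn]
    have : Complex.I * (n : ℂ) * ((2 * Real.pi : ℝ) : ℂ) = n * (2 * Real.pi * Complex.I) := by
      push_cast; ring
    rw [this, Complex.exp_int_mul_two_pi_mul_I]
    simp

/-- The factor in the radial Laplace integral giving the coefficients of the packet. -/
noncomputable def radialFactor (M e ε ξ a σ η x : ℝ) : ℂ :=
  (Complex.I * (σ * √(η ^ 2 + a ^ 2) : ℝ) + a) * x - (Complex.I * ξ + ε) +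
    ((x * fQuot M e x * (ε - a * x) : ℝ) : ℂ)

/-- The product of a mode function with the packet is a Laplace integral. -/
lemma kgInner_mode_packet {M e η₀ ε a σ : ℝ} {m : ℤ} {k : Mode} {F C : SpacetimeFun} (hM : 0 < M)
    (he : e ^ 2 < M ^ 2) (hF : HasModeData M e a σ k F) (hC : HasPacketData M e η₀ ε a m C) :
    kgInner M e 0 F C = if k.2 = m then
      Complex.I * (((1 / (k.1 ^ 2 + a ^ 2) ^ (1 / 4 : ℝ) * (1 / √2) : ℝ) : ℂ) *
      Complex.exp (-(Complex.I * k.1 * rPlus M e)) *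
      ∫ x in Set.Ioi 0, laplaceIntegrand (Complex.I * (xi0 M e η₀ : ℂ) + ε) (a + Complex.I * k.1)
        (radialFactor M e ε (xi0 M e η₀) a σ k.1) x) else 0 := by
  rw [hC.kgInner_eq_mul hM F (A := fun x =>
    ((1 / (k.1 ^ 2 + a ^ 2) ^ (1 / 4 : ℝ) * (1 / (√2 * (2 * Real.pi))) : ℝ) : ℂ) *
      Complex.exp (-(Complex.I * k.1 * rPlus M e)) *
      laplaceIntegrand (Complex.I * (xi0 M e η₀ : ℂ) + ε) (a + Complex.I * k.1)
        (radialFactor M e ε (xi0 M e η₀) a σ k.1) x)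
    (E := fun φ => Complex.exp (Complex.I * ((m - k.2 : ℤ) : ℂ) * φ)),
    integral_const_mul, integral_exp_int_mul]
  · by_cases hk : k.2 = m
    · rw [if_pos hk, if_pos (by omega)]
      have : (Real.pi : ℂ) ≠ 0 := by exact_mod_cast Real.pi_ne_zero
      push_cast
      field_simp
    · rw [if_neg hk, if_neg (by omega)]
      simp
  · intro ρ φ hρ
    have h0 : 0 < ρ := (rPlus_pos hM).trans hρ
    have hx : 0 < ρ - rPlus M e := sub_pos.mpr hρ
    have hxC : ((ρ - rPlus M e : ℝ) : ℂ) ≠ 0 := by exact_mod_cast hx.ne'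
    have hf := f_lt_one hM he hρ
    have h2f : 2 - f M e ρ ≠ 0 := by linarith
    have hcp := conj_modeValue_mul_packetValue (η₀ := η₀) (ε := ε) (a := a) m k h0 hρ φ
    -- After clearing `2 - f`, the terms `(f - 1)η` from `λ₀` and from the radial derivative of the
    -- mode cancel, and the `ξ/x` terms add up to `-iξ/x` without any `f`.
    have hbracket : ((2 - f M e ρ : ℝ) : ℂ) * (Complex.I * (beta M e η₀ ρ : ℂ) +
          Complex.I * (lambda0 M e a σ k ρ : ℂ)) +
        ((f M e ρ - 1 : ℝ) : ℂ) * (((ε / (ρ - rPlus M e) - a : ℝ) : ℂ) +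
          Complex.I * ((xi0 M e η₀ / (ρ - rPlus M e) : ℝ) : ℂ) + Complex.I * k.1) =
        radialFactor M e ε (xi0 M e η₀) a σ k.1 (ρ - rPlus M e) / ((ρ - rPlus M e : ℝ) : ℂ) := by
      have hb : (2 - f M e ρ) * beta M e η₀ ρ = -f M e ρ * (xi0 M e η₀ / (ρ - rPlus M e)) := by
        rw [beta, mul_div_cancel₀ _ h2f]
      have hl : (2 - f M e ρ) * lambda0 M e a σ k ρ =
          -(f M e ρ - 1) * k.1 + σ * √(k.1 ^ 2 + a ^ 2) := by
        rw [lambda0, mul_div_cancel₀ _ h2f]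
      have hbC := congrArg (fun z : ℝ => (z : ℂ)) hb
      have hlC := congrArg (fun z : ℝ => (z : ℂ)) hl
      rw [radialFactor, ← f_eq_mul_fQuot he h0.ne']
      generalize f M e ρ = fr at *
      generalize ρ - rPlus M e = x at *
      have hinv : (x : ℂ) * (x : ℂ)⁻¹ = 1 := mul_inv_cancel₀ hxC
      rw [eq_div_iff hxC]
      push_cast [div_eq_mul_inv] at hbC hlC ⊢
      linear_combination (Complex.I * x) * hbC + (Complex.I * x) * hlC +
        (-Complex.I * xi0 M e η₀ + (fr - 1) * ε) * hinv
    have hval := hF.value ρ φ h0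
    have hcpow : ((ρ - rPlus M e : ℝ) : ℂ) ^ (Complex.I * (xi0 M e η₀ : ℂ) + ε - 1) =
        ((ρ - rPlus M e : ℝ) : ℂ) ^ (Complex.I * (xi0 M e η₀ : ℂ) + ε) /
          ((ρ - rPlus M e : ℝ) : ℂ) := by
      rw [Complex.cpow_sub _ _ hxC, Complex.cpow_one]
    rw [kgIntegrand, hC.dRho_eq hM hρ, hC.dTime_eq h0 hρ.ne', hF.dRho_eq h0, hF.dTime_eq hM he hρ,
      hC.value ρ φ h0, hval, laplaceIntegrand, hcpow]
    simp only [map_mul, map_add, Complex.conj_ofReal, Complex.conj_I]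
    rw [div_eq_mul_inv] at hbracket ⊢
    push_cast at hbracket hcp ⊢
    linear_combination (conj (modeValue a k ρ φ) * packetValue M e η₀ ε a m ρ φ * ρ) * hbracket +
      (radialFactor M e ε (xi0 M e η₀) a σ k.1 (ρ - rPlus M e) * (ρ - rPlus M e : ℂ)⁻¹) * hcp

/-- The norm of the packet. -/
lemma kgInner_packet_self {M e η₀ ε a : ℝ} {m : ℤ} {C : SpacetimeFun} (hM : 0 < M)
    (he : e ^ 2 < M ^ 2) (hε : 0 < ε) (ha : 0 < a) (hC : HasPacketData M e η₀ ε a m C) :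
    kgInner M e 0 C C =
      ((4 * Real.pi * xi0 M e η₀ * ((1 / (2 * a)) ^ (2 * ε) * Real.Gamma (2 * ε)) : ℝ) : ℂ) := by
  rw [hC.kgInner_eq_mul hM C (E := fun _ => 1) (A := fun x => (-2 * Complex.I * xi0 M e η₀) *
    ((x ^ (2 * ε - 1) * Real.exp (-(2 * a * x)) : ℝ) : ℂ))]
  · rw [integral_const_mul, integral_complex_ofReal,
      Real.integral_rpow_mul_exp_neg_mul_Ioi (by positivity) (by positivity)]
    simp only [intervalIntegral.integral_const, sub_zero, Complex.real_smul, mul_one]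
    push_cast
    linear_combination (-4 * Real.pi * xi0 M e η₀ * ((((1 / (2 * a)) ^ (2 * ε) : ℝ) : ℂ) *
      Real.Gamma (2 * ε))) * Complex.I_sq
  · intro ρ φ hρ
    have h0 : 0 < ρ := (rPlus_pos hM).trans hρ
    have hx : 0 < ρ - rPlus M e := sub_pos.mpr hρ
    have h2f : 2 - f M e ρ ≠ 0 := by linarith [f_lt_one hM he hρ]
    -- The real parts of the logarithmic derivatives drop out by antisymmetry, and `-f + (f - 1) =
    -- -1` removes `f`, so the norm is an exact Gamma integral.
    have hb : (2 - f M e ρ) * beta M e η₀ ρ = -f M e ρ * (xi0 M e η₀ / (ρ - rPlus M e)) := by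
      rw [beta, mul_div_cancel₀ _ h2f]
    have hbC := congrArg (fun z : ℝ => (z : ℂ)) hb
    have hsq : conj (packetValue M e η₀ ε a m ρ φ) * packetValue M e η₀ ε a m ρ φ * ρ =
        (((ρ - rPlus M e) * ((ρ - rPlus M e) ^ (2 * ε - 1) *
          Real.exp (-(2 * a * (ρ - rPlus M e)))) : ℝ) : ℂ) := by
      rw [← Complex.normSq_eq_conj_mul_self, Complex.normSq_eq_norm_sq, ← Complex.ofReal_mul,
        packetValue, if_pos hρ, norm_mul, mul_comm Complex.I, Complex.norm_exp_ofReal_mul_I, mul_one,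
        Complex.norm_real, Real.norm_eq_abs, sq_abs]
      congr 1
      rw [Real.rpow_sub_one hx.ne', two_mul ε, Real.rpow_add hx, mul_pow, mul_pow, div_pow,
        Real.sq_sqrt h0.le, ← Real.exp_nat_mul]
      have : Real.exp ((2 : ℕ) * (-a * (ρ - rPlus M e))) =
          Real.exp (-(2 * a * (ρ - rPlus M e))) := by
        congr 1; push_cast; ring
      rw [this]
      field_simp
    rw [kgIntegrand, hC.dRho_eq hM hρ, hC.dTime_eq h0 hρ.ne', hC.value ρ φ h0]
    simp only [map_mul, map_add, Complex.conj_ofReal, Complex.conj_I]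
    generalize packetValue M e η₀ ε a m ρ φ = V at *
    generalize f M e ρ = fr at *
    have hinv : ((ρ - rPlus M e : ℝ) : ℂ) * ((ρ - rPlus M e : ℝ) : ℂ)⁻¹ = 1 :=
      mul_inv_cancel₀ (by exact_mod_cast hx.ne')
    generalize ρ - rPlus M e = x at *
    push_cast [div_eq_mul_inv] at hbC hsq ⊢
    linear_combination (2 * Complex.I * (conj V * V * ρ)) * hbC -
      (2 * Complex.I * xi0 M e η₀ * (x : ℂ)⁻¹) * hsq -
      (2 * Complex.I * xi0 M e η₀ * (((x ^ (2 * ε - 1) : ℝ) : ℂ) * Complex.exp (-(2 * a * x)))) * hinv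

/-! ### Asymptotics of the coefficients -/

lemma fQuot_nonneg {M e x : ℝ} (hM : 0 < M) (he : e ^ 2 < M ^ 2) (hx : 0 < x) :
    0 ≤ fQuot M e x := by
  have h0 := rPlus_pos (e := e) hM
  have h2 := sub_pos.mpr (rMinus_lt_rPlus he)
  rw [fQuot]; positivity

lemma fQuot_le {M e x : ℝ} (hM : 0 < M) (hx : 0 < x) :
    fQuot M e x ≤ 1 / rPlus M e := by
  have h0 := rPlus_pos (e := e) hM
  have h1 := rMinus_nonneg (e := e) hM
  rw [fQuot, div_le_div_iff₀ (by positivity) h0]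
  nlinarith [mul_pos hx h0]

/-- The derivative of `fQuot`. -/
noncomputable def fQuotDeriv (M e x : ℝ) : ℝ :=
  1 / (x + rPlus M e) ^ 2 - 2 * (x + (rPlus M e - rMinus M e)) / (x + rPlus M e) ^ 3

lemma hasDerivAt_fQuot {M e x : ℝ} (hM : 0 < M) (hx : 0 < x) :
    HasDerivAt (fQuot M e) (fQuotDeriv M e x) x := by
  have h0 := rPlus_pos (e := e) hM
  have hne : x + rPlus M e ≠ 0 := by positivity
  have h := ((hasDerivAt_id x).add_const (rPlus M e - rMinus M e)).div
    (((hasDerivAt_id x).add_const (rPlus M e)).pow 2) (pow_ne_zero 2 hne)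
  convert! h using 1
  simp only [fQuotDeriv, id, Pi.pow_apply]
  field_simp
  push_cast
  ring

/-- Integration by parts only sees `x q'(x)`, which is bounded by the same constant as `q`. -/
lemma abs_mul_fQuotDeriv_le {M e x : ℝ} (hM : 0 < M) (he : e ^ 2 < M ^ 2) (hx : 0 < x) :
    |x * fQuotDeriv M e x| ≤ 1 / rPlus M e := by
  have h0 := rPlus_pos (e := e) hM
  have h1 := rMinus_nonneg (e := e) hM
  have h2 := rMinus_lt_rPlus he
  have hrep : x * fQuotDeriv M e x =
      x * (2 * rMinus M e - rPlus M e - x) / (x + rPlus M e) ^ 3 := by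
    rw [fQuotDeriv]; field_simp; ring
  rw [hrep, abs_div, abs_of_pos (show 0 < (x + rPlus M e) ^ 3 by positivity), abs_mul, abs_of_pos hx,
    div_le_div_iff₀ (by positivity) h0, one_mul]
  have h3 : |2 * rMinus M e - rPlus M e - x| ≤ x + rPlus M e :=
    abs_le.mpr ⟨by linarith, by linarith⟩
  calc x * |2 * rMinus M e - rPlus M e - x| * rPlus M e
      ≤ (x + rPlus M e) * (x + rPlus M e) * (x + rPlus M e) := by gcongr <;> linarith
    _ = _ := by ring

/-- The remainder of the radial Laplace integral, caused by the curvature away from the horizon. -/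
noncomputable def radialRemainder (M e ε ξ a η : ℝ) : ℂ :=
  ∫ x in Set.Ioi 0, laplaceIntegrand (Complex.I * ξ + ε + 1) (a + Complex.I * η)
    (fun x => ((fQuot M e x * (ε - a * x) : ℝ) : ℂ)) x

/-- The constant in the bound of `radialRemainder`. -/
noncomputable def remainderConst (M e ε ξ : ℝ) : ℝ :=
  (‖Complex.I * (ξ : ℂ) + ε‖ + 2) / rPlus M e * (ε * Real.Gamma ε + Real.Gamma (ε + 1))

lemma continuousOn_fQuot {M e : ℝ} (hM : 0 < M) : ContinuousOn (fQuot M e) (Set.Ioi 0) :=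
  fun _ hx => (hasDerivAt_fQuot hM hx).continuousAt.continuousWithinAt

lemma norm_fQuot_mul_le {M e ε a x : ℝ} (hM : 0 < M) (he : e ^ 2 < M ^ 2) (hε : 0 < ε) (ha : 0 < a)
    (hx : 0 < x) : |fQuot M e x * (ε - a * x)| ≤ 1 / rPlus M e * (ε + a * x) := by
  have h0 := rPlus_pos (e := e) hM
  have hax := mul_pos ha hx
  rw [abs_mul, abs_of_nonneg (fQuot_nonneg hM he hx)]
  exact mul_le_mul (fQuot_le hM hx) (abs_le.mpr ⟨by linarith, by linarith⟩) (abs_nonneg _)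
    (by positivity)

lemma norm_ofReal_add_I_mul (a η : ℝ) : ‖(a + Complex.I * η : ℂ)‖ = √(η ^ 2 + a ^ 2) := by
  rw [mul_comm, Complex.norm_add_mul_I, add_comm]

/-- Integration by parts trades the factor `p`, of modulus `√(η² + a²)`, for the drop from `s + 1`
to `s`. This supplies decay in `η`, needed for square integrability, which the direct bound lacks.
-/
lemma norm_radialRemainder_le {M e ε ξ a : ℝ} (hM : 0 < M) (he : e ^ 2 < M ^ 2) (hε : 0 < ε)
    (ha : 0 < a) (η : ℝ) :
    √(η ^ 2 + a ^ 2) * ‖radialRemainder M e ε ξ a η‖ ≤ (1 / a) ^ ε * remainderConst M e ε ξ := by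
  have h0 := rPlus_pos (e := e) hM
  set s : ℂ := Complex.I * ξ + ε with hs
  -- In `s v + x v'`, the term `s v` accounts for `‖s‖`, and `x q'(ε - ax)` and `-a x q` for one
  -- unit each.
  set Q : ℝ := (‖s‖ + 2) / rPlus M e with hQ
  have hre : s.re = ε := by simp [hs]
  have hpre : (a + Complex.I * η : ℂ).re = a := by simp
  have hv : ∀ x : ℝ, 0 < x → ‖((fQuot M e x * (ε - a * x) : ℝ) : ℂ)‖ ≤ Q * ε + Q * a * x := by
    intro x hx
    rw [Complex.norm_real, Real.norm_eq_abs]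
    refine (norm_fQuot_mul_le hM he hε ha hx).trans ?_
    rw [show Q * ε + Q * a * x = Q * (ε + a * x) by ring, hQ]
    have := norm_nonneg s
    gcongr
    linarith
  have hv' : ∀ x : ℝ, 0 < x → ‖s * ((fQuot M e x * (ε - a * x) : ℝ) : ℂ) +
      x * ((fQuotDeriv M e x * (ε - a * x) + fQuot M e x * (-a) : ℝ) : ℂ)‖ ≤
        Q * ε + Q * a * x := by
    intro x hx
    have hax := mul_pos ha hx
    have hr : 0 < 1 / rPlus M e := by positivity
    refine (norm_add_le _ _).trans ?_
    rw [norm_mul, ← Complex.ofReal_mul, Complex.norm_real, Complex.norm_real, Real.norm_eq_abs,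
      Real.norm_eq_abs]
    have b1 := norm_fQuot_mul_le hM he hε ha hx
    have b2 : |x * (fQuotDeriv M e x * (ε - a * x) + fQuot M e x * (-a))| ≤
        1 / rPlus M e * (ε + a * x) + 1 / rPlus M e * (a * x) := by
      rw [show x * (fQuotDeriv M e x * (ε - a * x) + fQuot M e x * (-a)) =
        x * fQuotDeriv M e x * (ε - a * x) + -(fQuot M e x * (a * x)) by ring]
      refine (abs_add_le _ _).trans (add_le_add ?_ ?_)
      · rw [abs_mul]
        exact mul_le_mul (abs_mul_fQuotDeriv_le hM he hx)
          (abs_le.mpr ⟨by linarith, by linarith⟩) (abs_nonneg _) hr.le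
      · rw [abs_neg, abs_mul, abs_of_pos hax, abs_of_nonneg (fQuot_nonneg hM he hx)]
        exact mul_le_mul_of_nonneg_right (fQuot_le hM hx) hax.le
    have b3 := mul_le_mul_of_nonneg_left b1 (norm_nonneg s)
    have hQ' : Q = 1 / rPlus M e * ‖s‖ + 2 * (1 / rPlus M e) := by rw [hQ]; ring
    rw [hQ']
    nlinarith [mul_pos hr hε]
  have key := mul_integral_laplaceIntegrand (s := s) (p := a + Complex.I * η)
    (by rw [hre]; exact hε) (by rw [hpre]; exact ha)
    (v := fun x => ((fQuot M e x * (ε - a * x) : ℝ) : ℂ))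
    (v' := fun x => ((fQuotDeriv M e x * (ε - a * x) + fQuot M e x * (-a) : ℝ) : ℂ))
    (fun x hx => by
      have h2 : HasDerivAt (fun x => ε - a * x) (-a) x := by
        simpa using ((hasDerivAt_id x).const_mul a).const_sub ε
      exact ((hasDerivAt_fQuot hM hx).mul h2).ofReal_comp)
    (by
      have := continuousOn_fQuot (e := e) hM
      have h2 : ContinuousOn (fQuotDeriv M e) (Set.Ioi 0) := by
        have hne : ∀ x ∈ Set.Ioi (0 : ℝ), x + rPlus M e ≠ 0 := fun x hx =>
          (add_pos hx h0).ne'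
        unfold fQuotDeriv
        refine ContinuousOn.sub (ContinuousOn.div ?_ ?_ ?_) (ContinuousOn.div ?_ ?_ ?_)
        any_goals fun_prop
        · exact fun x hx => pow_ne_zero _ (hne x hx)
        · exact fun x hx => pow_ne_zero _ (hne x hx)
      exact Complex.continuous_ofReal.comp_continuousOn (by fun_prop))
    hv hv'
  rw [← norm_ofReal_add_I_mul, ← norm_mul, radialRemainder, key]
  refine (norm_integral_laplaceIntegrand_le (by rw [hre]; exact hε) (by rw [hpre]; exact ha)
    hv').trans (le_of_eq ?_)
  rw [hre, hpre, remainderConst, ← hs, ← hQ]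
  field_simp

lemma continuous_radialRemainder {M e ε ξ a : ℝ} (hM : 0 < M) (he : e ^ 2 < M ^ 2) (hε : 0 < ε)
    (ha : 0 < a) : Continuous (radialRemainder M e ε ξ a) := by
  unfold radialRemainder
  have hcf := continuousOn_fQuot (e := e) hM
  have hc : ContinuousOn (fun x => ((fQuot M e x * (ε - a * x) : ℝ) : ℂ)) (Set.Ioi 0) :=
    Complex.continuous_ofReal.comp_continuousOn (by fun_prop)
  refine continuous_of_dominated (bound := laplaceMajorant (ε + 1) a
    (1 / rPlus M e * ε) (1 / rPlus M e * a)) ?_ ?_ ?_ ?_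
  · exact fun η => (continuousOn_laplaceIntegrand hc).aestronglyMeasurable measurableSet_Ioi
  · intro η
    filter_upwards [ae_restrict_mem measurableSet_Ioi] with x hx
    have h := norm_laplaceIntegrand_le (s := Complex.I * ξ + ε + 1) (p := a + Complex.I * η)
      (g := fun x => ((fQuot M e x * (ε - a * x) : ℝ) : ℂ)) (A := 1 / rPlus M e * ε)
      (B := 1 / rPlus M e * a) hx (by
        rw [Complex.norm_real, Real.norm_eq_abs]
        exact (norm_fQuot_mul_le hM he hε ha hx).trans (le_of_eq (by ring)))
    simpa using h
  · exact integrableOn_laplaceMajorant (by linarith) ha _ _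
  · refine Eventually.of_forall fun x => ?_
    unfold laplaceIntegrand
    fun_prop

lemma laplaceIntegrand_add_one (s p : ℂ) (g : ℝ → ℂ) {x : ℝ} (hx : 0 < x) :
    laplaceIntegrand (s + 1) p g x = x * laplaceIntegrand s p g x := by
  have h3 : (x : ℂ) ^ (s + 1 - 1) = (x : ℂ) ^ (s - 1) * x := by
    rw [add_sub_right_comm, Complex.cpow_add _ _ (by exact_mod_cast hx.ne'), Complex.cpow_one]
  rw [laplaceIntegrand, laplaceIntegrand, h3]; ring

/-- With `Γ(s+1) = sΓ(s)` and `p^{-s} = p · p^{-(s+1)}` the two Gamma integrals share a factor, and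
`iσ√(η²+a²) + a - p = i(σ√(η²+a²) - η)`. -/
lemma integral_radialFactor {M e ε ξ a : ℝ} (σ : ℝ) (hM : 0 < M) (he : e ^ 2 < M ^ 2) (hε : 0 < ε)
    (ha : 0 < a) (η : ℝ) :
    ∫ x in Set.Ioi 0, laplaceIntegrand (Complex.I * ξ + ε) (a + Complex.I * η)
        (radialFactor M e ε ξ a σ η) x =
      Complex.I * ((Complex.I * ξ + ε) * Complex.Gamma (Complex.I * ξ + ε)) *
        (a + Complex.I * η) ^ (-(Complex.I * ξ + ε + 1)) * (σ * √(η ^ 2 + a ^ 2) - η : ℝ) +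
      radialRemainder M e ε ξ a η := by
  have hcf := continuousOn_fQuot (e := e) hM
  have hc : ContinuousOn (fun x => ((fQuot M e x * (ε - a * x) : ℝ) : ℂ)) (Set.Ioi 0) :=
    Complex.continuous_ofReal.comp_continuousOn (by fun_prop)
  have hs0 : 0 < (Complex.I * ξ + ε : ℂ).re := by simpa using hε
  have hs1 : 0 < (Complex.I * ξ + ε + 1 : ℂ).re := by simp; linarith
  have hp0 : 0 < (a + Complex.I * η : ℂ).re := by simpa using ha
  have hpne : (a + Complex.I * η : ℂ) ≠ 0 := fun h => by simp [h] at hp0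
  have hsne : (Complex.I * ξ + ε : ℂ) ≠ 0 := fun h => by simp [h] at hs0
  have i1 := integrableOn_laplaceIntegrand_one hs1 hp0
  have i2 := integrableOn_laplaceIntegrand_one hs0 hp0
  have i3 := integrableOn_laplaceIntegrand (A := 1 / rPlus M e * ε) (B := 1 / rPlus M e * a)
    hs1 hp0 hc (fun x hx => by
        rw [Complex.norm_real, Real.norm_eq_abs]
        exact (norm_fQuot_mul_le hM he hε ha hx).trans (le_of_eq (by ring)))
  have e1 := integral_laplaceIntegrand_one hs1 ha η
  have e2 := integral_laplaceIntegrand_one hs0 ha η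
  rw [Complex.Gamma_add_one _ hsne] at e1
  have hpow : (a + Complex.I * η : ℂ) ^ (-(Complex.I * ξ + ε) : ℂ) =
      (a + Complex.I * η : ℂ) ^ (-(Complex.I * ξ + ε + 1) : ℂ) * (a + Complex.I * η) := by
    rw [show (-(Complex.I * ξ + ε) : ℂ) = -(Complex.I * ξ + ε + 1) + 1 by ring,
      Complex.cpow_add _ _ hpne, Complex.cpow_one]
  rw [hpow] at e2
  have hfac : ∀ x : ℝ, radialFactor M e ε ξ a σ η x =
    (Complex.I * (σ * √(η ^ 2 + a ^ 2) : ℝ) + a) * x - (Complex.I * ξ + ε) +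
    ((x * fQuot M e x * (ε - a * x) : ℝ) : ℂ) := fun _ => rfl
  unfold radialRemainder
  generalize (Complex.I * ξ + ε : ℂ) = s at *
  have i4 : IntegrableOn (fun x => (Complex.I * (σ * √(η ^ 2 + a ^ 2) : ℝ) + a) *
        laplaceIntegrand (s + 1) (a + Complex.I * η) 1 x -
      s * laplaceIntegrand s (a + Complex.I * η) 1 x) (Set.Ioi 0) :=
    (i1.const_mul _).sub (i2.const_mul _)
  rw [setIntegral_congr_fun (g := fun x =>
      (Complex.I * (σ * √(η ^ 2 + a ^ 2) : ℝ) + a) *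
        laplaceIntegrand (s + 1) (a + Complex.I * η) 1 x -
      s * laplaceIntegrand s (a + Complex.I * η) 1 x +
      laplaceIntegrand (s + 1) (a + Complex.I * η)
        (fun x => ((fQuot M e x * (ε - a * x) : ℝ) : ℂ)) x) measurableSet_Ioi ?_]
  · rw [integral_add i4 i3,
      integral_sub (i1.const_mul _) (i2.const_mul _), integral_const_mul, integral_const_mul, e1, e2]
    push_cast
    ring
  · intro x hx
    simp only [laplaceIntegrand_add_one s _ _ hx]
    simp only [laplaceIntegrand, hfac, Pi.one_apply]
    push_cast
    ring

/-- The coefficient of the packet on the modes with `k.2 = m`, as a function of `η_ρ`. -/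
noncomputable def modeCoeff (M e ε ξ a σ η : ℝ) : ℂ :=
  Complex.I * (((1 / (η ^ 2 + a ^ 2) ^ (1 / 4 : ℝ) * (1 / √2) : ℝ) : ℂ) *
      Complex.exp (-(Complex.I * η * rPlus M e)) *
      ∫ x in Set.Ioi 0, laplaceIntegrand (Complex.I * ξ + ε) (a + Complex.I * η)
        (radialFactor M e ε ξ a σ η) x)

lemma norm_modeCoeff (M e ε ξ a σ η : ℝ) : ‖modeCoeff M e ε ξ a σ η‖ =
    1 / (η ^ 2 + a ^ 2) ^ (1 / 4 : ℝ) * (1 / √2) *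
      ‖∫ x in Set.Ioi 0, laplaceIntegrand (Complex.I * ξ + ε) (a + Complex.I * η)
        (radialFactor M e ε ξ a σ η) x‖ := by
  have h : ‖Complex.exp (-(Complex.I * η * rPlus M e))‖ = 1 := by
    rw [Complex.norm_exp]; simp
  rw [modeCoeff, norm_mul, norm_mul, norm_mul, h, Complex.norm_I, Complex.norm_real, Real.norm_eq_abs,
    abs_of_nonneg (by positivity), one_mul, mul_one]

lemma continuous_modeCoeff {M e ε a : ℝ} (ξ σ : ℝ) (hM : 0 < M) (he : e ^ 2 < M ^ 2) (hε : 0 < ε)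
    (ha : 0 < a) : Continuous (modeCoeff M e ε ξ a σ) := by
  have h1 := continuous_radialRemainder (ξ := ξ) hM he hε ha
  have h2 : Continuous fun η : ℝ => (a + Complex.I * η : ℂ) ^ (-(Complex.I * ξ + ε + 1) : ℂ) :=
    Continuous.cpow (by fun_prop) continuous_const fun η => Or.inl (by simpa using ha)
  have h3 : Continuous fun η : ℝ => 1 / (η ^ 2 + a ^ 2) ^ (1 / 4 : ℝ) * (1 / √2) :=
    (Continuous.div continuous_const
      (Continuous.rpow_const (by fun_prop) fun η => Or.inr (by norm_num))
      fun η => (Real.rpow_pos_of_pos (by positivity) _).ne').mul continuous_const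
  unfold modeCoeff
  simp only [integral_radialFactor σ hM he hε ha]
  have h4 := Complex.continuous_ofReal.comp h3
  simp only [Function.comp_def] at h4
  fun_prop

/-! ### The limiting profile and the rescaling `η = a y`. -/

/-- The limit of the modulus of the rescaled coefficient. -/
noncomputable def modeProfile (ε ξ σ y : ℝ) : ℝ :=
  1 / (y ^ 2 + 1) ^ (1 / 4 : ℝ) * (1 / √2) *
    (‖(Complex.I * ξ + ε) * Complex.Gamma (Complex.I * ξ + ε)‖ *
      ‖(1 + Complex.I * y : ℂ) ^ (-(Complex.I * ξ + ε + 1) : ℂ)‖ * |σ * √(y ^ 2 + 1) - y|)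

lemma one_add_I_mul_ne_zero (y : ℝ) : (1 + Complex.I * y : ℂ) ≠ 0 :=
  fun h => by simpa using congrArg Complex.re h

lemma norm_cpow_scaled (ε ξ y : ℝ) {a : ℝ} (ha : 0 < a) :
    ‖(a + Complex.I * (a * y : ℝ) : ℂ) ^ (-(Complex.I * ξ + ε + 1) : ℂ)‖ =
      a ^ (-(ε + 1)) * ‖(1 + Complex.I * y : ℂ) ^ (-(Complex.I * ξ + ε + 1) : ℂ)‖ := by
  have hz := one_add_I_mul_ne_zero y
  have haz : (a + Complex.I * (a * y : ℝ) : ℂ) = a * (1 + Complex.I * y) := by push_cast; ring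
  have hre : (-(Complex.I * ξ + ε + 1) : ℂ).re = -(ε + 1) := by simp
  rw [haz, Complex.norm_cpow_of_ne_zero (mul_ne_zero (by exact_mod_cast ha.ne') hz),
    Complex.norm_cpow_of_ne_zero hz, Complex.arg_real_mul _ ha, norm_mul, Complex.norm_real,
    Real.norm_of_nonneg ha.le, Real.mul_rpow ha.le (norm_nonneg _), hre]
  ring

/-- The main term scales exactly, so the difference comes from the remainder alone. The exponent
`-3/4` is `-1/4` from the mode normalization plus `-1/2` from the remainder bound. -/
lemma abs_scaled_modeCoeff_sub_le {M e ε a : ℝ} (ξ σ y : ℝ) (hM : 0 < M) (he : e ^ 2 < M ^ 2)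
    (hε : 0 < ε) (ha : 0 < a) :
    |√a * (a ^ ε * ‖modeCoeff M e ε ξ a σ (a * y)‖) - modeProfile ε ξ σ y| ≤
      1 / √2 * remainderConst M e ε ξ / a * (1 + y ^ 2) ^ (-3 / 4 : ℝ) := by
  have hW : 0 < y ^ 2 + 1 := by positivity
  have hsq : (a * y) ^ 2 + a ^ 2 = a ^ 2 * (y ^ 2 + 1) := by ring
  have hsqrt : √((a * y) ^ 2 + a ^ 2) = a * √(y ^ 2 + 1) := by
    rw [hsq, Real.sqrt_mul (sq_nonneg a), Real.sqrt_sq ha.le]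
  have hquart : ((a * y) ^ 2 + a ^ 2) ^ (1 / 4 : ℝ) = √a * (y ^ 2 + 1) ^ (1 / 4 : ℝ) := by
    rw [hsq, Real.mul_rpow (sq_nonneg a) hW.le, ← Real.rpow_natCast, ← Real.rpow_mul ha.le,
      Real.sqrt_eq_rpow]
    norm_num
  have hR := norm_radialRemainder_le (ξ := ξ) hM he hε ha (a * y)
  have hcp := norm_cpow_scaled ε ξ y ha
  rw [hsqrt] at hR
  rw [norm_modeCoeff, integral_radialFactor σ hM he hε ha, hsqrt, hquart, modeProfile]
  set R := radialRemainder M e ε ξ a (a * y)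
  set B := (y ^ 2 + 1) ^ (1 / 4 : ℝ) with hB
  have hB0 : 0 < B := Real.rpow_pos_of_pos hW _
  have hsa : 0 < √a := Real.sqrt_pos.mpr ha
  set main := Complex.I * ((Complex.I * ξ + ε) * Complex.Gamma (Complex.I * ξ + ε)) *
        (a + Complex.I * (a * y : ℝ) : ℂ) ^ (-(Complex.I * ξ + ε + 1) : ℂ) *
        (σ * (a * √(y ^ 2 + 1)) - a * y : ℝ) with hmain
  have hmainNorm : a ^ ε * ‖main‖ =
      ‖(Complex.I * ξ + ε) * Complex.Gamma (Complex.I * ξ + ε)‖ *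
      ‖(1 + Complex.I * y : ℂ) ^ (-(Complex.I * ξ + ε + 1) : ℂ)‖ * |σ * √(y ^ 2 + 1) - y| := by
    rw [hmain, norm_mul, norm_mul, norm_mul Complex.I, Complex.norm_I, hcp, Complex.norm_real,
      Real.norm_eq_abs, show σ * (a * √(y ^ 2 + 1)) - a * y = a * (σ * √(y ^ 2 + 1) - y) by ring,
      abs_mul, abs_of_pos ha, Real.rpow_neg ha.le, Real.rpow_add_one ha.ne']
    field_simp
  rw [← hmainNorm]
  have hfac : √a * (a ^ ε * (1 / (√a * B) * (1 / √2) * ‖main + R‖)) -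
      1 / B * (1 / √2) * (a ^ ε * ‖main‖) =
      1 / B * (1 / √2) * (a ^ ε * (‖main + R‖ - ‖main‖)) := by
    field_simp
  have haε : 0 < a ^ ε := Real.rpow_pos_of_pos ha _
  have hdiff : |‖main + R‖ - ‖main‖| ≤ ‖R‖ := by
    simpa using abs_norm_sub_norm_le (main + R) main
  have hRb : a ^ ε * ‖R‖ ≤ remainderConst M e ε ξ / (a * √(y ^ 2 + 1)) := by
    rw [le_div_iff₀ (by positivity)]
    rw [one_div, Real.inv_rpow ha.le] at hR
    calc a ^ ε * ‖R‖ * (a * √(y ^ 2 + 1)) = a ^ ε * (a * √(y ^ 2 + 1) * ‖R‖) := by ring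
      _ ≤ a ^ ε * ((a ^ ε)⁻¹ * remainderConst M e ε ξ) := by gcongr
      _ = _ := by field_simp
  have hpow : (1 + y ^ 2) ^ (-3 / 4 : ℝ) = 1 / B * (1 / √(y ^ 2 + 1)) := by
    rw [hB, Real.sqrt_eq_rpow, one_div_mul_one_div, ← Real.rpow_add hW, one_div,
      ← Real.rpow_neg hW.le, add_comm]
    norm_num
  rw [hfac, abs_mul, abs_mul (a ^ ε), abs_of_pos haε, abs_of_pos (by positivity), hpow]
  calc 1 / B * (1 / √2) * (a ^ ε * |‖main + R‖ - ‖main‖|)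
      ≤ 1 / B * (1 / √2) * (remainderConst M e ε ξ / (a * √(y ^ 2 + 1))) := by
        gcongr
        exact (mul_le_mul_of_nonneg_left hdiff haε.le).trans hRb
    _ = _ := by field_simp

lemma norm_one_add_I_mul_cpow_sq (ε ξ y : ℝ) :
    ‖(1 + Complex.I * y : ℂ) ^ (-(Complex.I * ξ + ε + 1) : ℂ)‖ ^ 2 =
      (y ^ 2 + 1) ^ (-ε - 1) * Real.exp (2 * ξ * Complex.arg (1 + Complex.I * y)) := by
  have hre : (-(Complex.I * ξ + ε + 1) : ℂ).re = -ε - 1 := by simp; ring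
  have him : (-(Complex.I * ξ + ε + 1) : ℂ).im = -ξ := by simp
  have hn : ‖(1 + Complex.I * y : ℂ)‖ = √(y ^ 2 + 1) := by
    simpa using norm_ofReal_add_I_mul 1 y
  rw [Complex.norm_cpow_of_ne_zero (one_add_I_mul_ne_zero y), hre, him, hn, div_pow,
    ← Real.exp_nat_mul, ← Real.rpow_natCast, ← Real.rpow_mul (Real.sqrt_nonneg _), mul_comm (-ε - 1),
    Real.rpow_mul (Real.sqrt_nonneg _), Real.rpow_natCast, Real.sq_sqrt (by positivity),
    div_eq_mul_inv, ← Real.exp_neg]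
  congr 2
  push_cast; ring

lemma modeProfile_sq (ε ξ σ y : ℝ) : modeProfile ε ξ σ y ^ 2 =
    1 / 2 * ‖(Complex.I * ξ + ε) * Complex.Gamma (Complex.I * ξ + ε)‖ ^ 2 *
      ((y ^ 2 + 1) ^ (-ε - 1) * Real.exp (2 * ξ * Complex.arg (1 + Complex.I * y))) *
      ((σ * √(y ^ 2 + 1) - y) ^ 2 / √(y ^ 2 + 1)) := by
  have hW : 0 < y ^ 2 + 1 := by positivity
  have hq : ((y ^ 2 + 1) ^ (1 / 4 : ℝ)) ^ 2 = √(y ^ 2 + 1) := by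
    rw [← Real.rpow_natCast, ← Real.rpow_mul hW.le, Real.sqrt_eq_rpow]; norm_num
  rw [modeProfile, ← norm_one_add_I_mul_cpow_sq, mul_pow, mul_pow, mul_pow, mul_pow, sq_abs, div_pow,
    div_pow, hq, Real.sq_sqrt (by norm_num)]
  ring

/-- Since `y + i = i(1 - iy)`, the argument shifts by `π/2`; the resulting `e^{πξ}` and the `e^{πξ}`
in `|Γ₁|²` together cancel `e^{-2πξ}`. -/
lemma C3_eq (ε ξ y : ℝ) : C3 ε ξ y = modeProfile ε ξ 1 (-y) ^ 2 := by
  have hW : 0 < y ^ 2 + 1 := by positivity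
  have harg : Complex.arg ((y : ℂ) + Complex.I) =
      Real.pi / 2 + Complex.arg (1 + Complex.I * ((-y : ℝ) : ℂ)) := by
    have h1 : |Complex.arg (1 + Complex.I * ((-y : ℝ) : ℂ))| < Real.pi / 2 :=
      Complex.abs_arg_lt_pi_div_two_iff.mpr (Or.inl (by simp))
    obtain ⟨h2, h3⟩ := abs_lt.mp h1
    have hI : (y : ℂ) + Complex.I = Complex.I * (1 + Complex.I * ((-y : ℝ) : ℂ)) := by
      push_cast; linear_combination (y : ℂ) * Complex.I_sq
    rw [hI, Complex.arg_mul Complex.I_ne_zero (one_add_I_mul_ne_zero _), Complex.arg_I]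
    rw [Complex.arg_I]
    exact ⟨by linarith [Real.pi_pos], by linarith⟩
  have hs : ‖(ξ : ℂ) + Complex.I * (ε : ℂ)‖ = ‖Complex.I * (ξ : ℂ) + ε‖ := by
    rw [norm_ofReal_add_I_mul, add_comm _ (ε : ℂ), norm_ofReal_add_I_mul, add_comm]
  have hq : ((y ^ 2 + 1) ^ (1 / 4 : ℝ)) ^ 2 = √(y ^ 2 + 1) := by
    rw [← Real.rpow_natCast, ← Real.rpow_mul hW.le, Real.sqrt_eq_rpow]; norm_num
  have hfrac : |y / (y ^ 2 + 1) ^ (1 / 4 : ℝ) + (y ^ 2 + 1) ^ (1 / 4 : ℝ)| ^ 2 =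
      (1 * √(y ^ 2 + 1) + y) ^ 2 / √(y ^ 2 + 1) := by
    have hB : (y ^ 2 + 1) ^ (1 / 4 : ℝ) ≠ 0 := (Real.rpow_pos_of_pos hW _).ne'
    rw [sq_abs, ← hq]
    field_simp
    ring
  have hexp : Real.exp (-2 * Real.pi * ξ) * Real.exp (Real.pi / 2 * ξ) ^ 2 *
      Real.exp (2 * ξ * (Real.pi / 2 + Complex.arg (1 + Complex.I * ((-y : ℝ) : ℂ)))) =
      Real.exp (2 * ξ * Complex.arg (1 + Complex.I * ((-y : ℝ) : ℂ))) := by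
    rw [← Real.exp_nat_mul, ← Real.exp_add, ← Real.exp_add]
    congr 1; push_cast; ring
  rw [C3, modeProfile_sq, gamma1, harg, hs, hfrac, norm_mul, norm_mul, mul_pow, mul_pow,
    Complex.norm_exp_ofReal, ← hexp, neg_sq, sub_neg_eq_add]
  ring

lemma continuous_modeProfile (ε ξ σ : ℝ) : Continuous (modeProfile ε ξ σ) := by
  have h2 : Continuous fun y : ℝ => (1 + Complex.I * y : ℂ) ^ (-(Complex.I * ξ + ε + 1) : ℂ) :=
    Continuous.cpow (by fun_prop) continuous_const fun η => Or.inl (by simp)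
  have h3 : Continuous fun y : ℝ => 1 / (y ^ 2 + 1) ^ (1 / 4 : ℝ) * (1 / √2) :=
    (Continuous.div continuous_const
      (Continuous.rpow_const (by fun_prop) fun η => Or.inr (by norm_num))
      fun η => (Real.rpow_pos_of_pos (by positivity) _).ne').mul continuous_const
  unfold modeProfile
  fun_prop

/-- The square is bounded by a multiple of `(1 + y²)^{-ε-1/2}`, integrable exactly because `ε > 0`.
-/
lemma integrable_modeProfile_sq {ε σ : ℝ} (ξ : ℝ) (hε : 0 < ε) (hσ : |σ| ≤ 1) :
    Integrable (fun y => modeProfile ε ξ σ y ^ 2) := by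
  have hint : Integrable (fun y : ℝ => (1 + ‖y‖ ^ 2) ^ (-(2 * ε + 1) / 2)) :=
    integrable_rpow_neg_one_add_norm_sq (by simp; linarith)
  refine (hint.const_mul (1 / 2 * ‖(Complex.I * ξ + ε) * Complex.Gamma (Complex.I * ξ + ε)‖ ^ 2 *
    Real.exp (2 * |ξ| * Real.pi) * 4)).mono'
    ((continuous_modeProfile ε ξ σ).pow 2).aestronglyMeasurable (Eventually.of_forall fun y => ?_)
  have hW : 0 < y ^ 2 + 1 := by positivity
  have hexp : Real.exp (2 * ξ * Complex.arg (1 + Complex.I * y)) ≤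
      Real.exp (2 * |ξ| * Real.pi) := by
    refine Real.exp_le_exp.mpr ((le_abs_self _).trans ?_)
    rw [abs_mul, abs_mul, abs_two]
    exact mul_le_mul_of_nonneg_left (Complex.abs_arg_le_pi _) (by positivity)
  have hy : |y| ≤ √(y ^ 2 + 1) := Real.abs_le_sqrt (by linarith)
  have hnum : (σ * √(y ^ 2 + 1) - y) ^ 2 ≤ (2 * √(y ^ 2 + 1)) ^ 2 := by
    refine sq_le_sq' ?_ ?_ <;>
    · obtain ⟨h1, h2⟩ := abs_le.mp hy
      obtain ⟨h3, h4⟩ := abs_le.mp hσ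
      nlinarith [Real.sqrt_nonneg (y ^ 2 + 1)]
  have hfrac : (σ * √(y ^ 2 + 1) - y) ^ 2 / √(y ^ 2 + 1) ≤ 4 * √(y ^ 2 + 1) := by
    rw [div_le_iff₀ (Real.sqrt_pos.mpr hW)]
    linarith
  have hpow : (y ^ 2 + 1) ^ (-ε - 1) * √(y ^ 2 + 1) = (1 + ‖y‖ ^ 2) ^ (-(2 * ε + 1) / 2) := by
    rw [Real.sqrt_eq_rpow, ← Real.rpow_add hW, Real.norm_eq_abs, sq_abs, add_comm (y ^ 2)]
    congr 1; ring
  rw [Real.norm_of_nonneg (sq_nonneg _), modeProfile_sq, ← hpow]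
  calc _ ≤ 1 / 2 * ‖(Complex.I * ξ + ε) * Complex.Gamma (Complex.I * ξ + ε)‖ ^ 2 *
      ((y ^ 2 + 1) ^ (-ε - 1) * Real.exp (2 * |ξ| * Real.pi)) * (4 * √(y ^ 2 + 1)) := by gcongr
    _ = _ := by ring

lemma integrable_C3 {ε : ℝ} (ξ : ℝ) (hε : 0 < ε) : Integrable (C3 ε ξ) := by
  rw [funext (C3_eq ε ξ)]
  exact (integrable_modeProfile_sq ξ hε (by simp)).comp_neg

/-! ### Rescaled limits -/

lemma integrable_one_add_sq_rpow : Integrable (fun y : ℝ => ((1 + y ^ 2) ^ (-3 / 4 : ℝ)) ^ 2) := by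
  have hint : Integrable (fun y : ℝ => (1 + ‖y‖ ^ 2) ^ (-(3 : ℝ) / 2)) :=
    integrable_rpow_neg_one_add_norm_sq (by simp)
  refine hint.congr (Eventually.of_forall fun y => ?_)
  simp only [Real.norm_eq_abs, sq_abs]
  rw [← Real.rpow_mul_natCast (by positivity)]
  norm_num

lemma sq_le_of_abs_sub_le {u p b : ℝ} (h : |u - p| ≤ b) : u ^ 2 ≤ 2 * p ^ 2 + 2 * b ^ 2 := by
  have h1 : (u - p) ^ 2 ≤ b ^ 2 := sq_le_sq' (by linarith [(abs_le.mp h).1]) (abs_le.mp h).2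
  nlinarith [sq_nonneg (u - 2 * p)]

lemma integrable_sq_of_scaled {c P : ℝ → ℝ} {K a : ℝ} (ha : 0 < a) (hc : Continuous c)
    (hP : Integrable fun y => P y ^ 2)
    (h : ∀ y, |√a * c (a * y) - P y| ≤ K / a * (1 + y ^ 2) ^ (-3 / 4 : ℝ)) :
    Integrable fun η => c η ^ 2 := by
  rw [← integrable_comp_mul_left_iff _ ha.ne']
  have hb := ((hP.const_mul 2).add (integrable_one_add_sq_rpow.const_mul (2 * (K / a) ^ 2))).mono'
    (f := fun y => (√a * c (a * y)) ^ 2)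
    (by fun_prop) (Eventually.of_forall fun y => by
      rw [Real.norm_of_nonneg (sq_nonneg _)]
      exact (sq_le_of_abs_sub_le (h y)).trans (le_of_eq (by simp only [Pi.add_apply]; ring)))
  refine (hb.const_mul a⁻¹).congr (Eventually.of_forall fun y => ?_)
  simp only [mul_pow, Real.sq_sqrt ha.le]
  rw [inv_mul_cancel_left₀ ha.ne']

/-- The Jacobian `a` is absorbed by the `√a` in the hypothesis, and `S` is a cone, so the domain of
integration stays fixed. -/
lemma tendsto_setIntegral_sq_of_scaled {c : ℝ → ℝ → ℝ} {P : ℝ → ℝ} {K : ℝ} {S : Set ℝ}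
    (hS : MeasurableSet S) (hscale : ∀ a, 0 < a → ∀ y, a * y ∈ S ↔ y ∈ S)
    (hc : ∀ a, 0 < a → Continuous (c a)) (hP : Integrable fun y => P y ^ 2)
    (h : ∀ a, 0 < a → ∀ y, |√a * c a (a * y) - P y| ≤ K / a * (1 + y ^ 2) ^ (-3 / 4 : ℝ)) :
    Tendsto (fun a => ∫ η in S, c a η ^ 2) atTop (𝓝 (∫ y in S, P y ^ 2)) := by
  have hcv : ∀ a, 0 < a → ∫ η in S, c a η ^ 2 = ∫ y in S, (√a * c a (a * y)) ^ 2 := by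
    intro a ha
    have h1 := Measure.integral_comp_mul_left (S.indicator fun η => c a η ^ 2) a
    rw [abs_of_pos (inv_pos.mpr ha), smul_eq_mul, integral_indicator hS] at h1
    have h2 : ∫ η in S, c a η ^ 2 = a * ∫ y, S.indicator (fun η => c a η ^ 2) (a * y) := by
      rw [h1, mul_inv_cancel_left₀ ha.ne']
    rw [h2, ← integral_const_mul, ← integral_indicator hS]
    congr 1 with y
    by_cases hy : y ∈ S
    · rw [Set.indicator_of_mem hy, Set.indicator_of_mem ((hscale a ha y).mpr hy), mul_pow,
        Real.sq_sqrt ha.le]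
    · rw [Set.indicator_of_notMem hy, Set.indicator_of_notMem (mt (hscale a ha y).mp hy), mul_zero]
  have hlim : Tendsto (fun a => ∫ y in S, (√a * c a (a * y)) ^ 2) atTop
      (𝓝 (∫ y in S, P y ^ 2)) := by
    refine tendsto_integral_filter_of_dominated_convergence
      (fun y => 2 * P y ^ 2 + 2 * K ^ 2 * ((1 + y ^ 2) ^ (-3 / 4 : ℝ)) ^ 2) ?_ ?_ ?_ ?_
    · filter_upwards [eventually_gt_atTop 0] with a ha
      have := hc a ha
      exact Continuous.aestronglyMeasurable (by fun_prop)
    -- For `a ≥ 1` the error constant `(K/a)²` is at most `K²`, giving a majorant independent of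
    -- `a`.
    · filter_upwards [eventually_ge_atTop 1] with a ha
      refine Eventually.of_forall fun y => ?_
      have ha0 : 0 < a := by linarith
      rw [Real.norm_of_nonneg (sq_nonneg _)]
      refine (sq_le_of_abs_sub_le (h a ha0 y)).trans ?_
      have : (K / a) ^ 2 ≤ K ^ 2 := by
        rw [div_pow]
        exact div_le_self (sq_nonneg K) (one_le_pow₀ ha)
      rw [mul_pow, ← mul_assoc]
      gcongr
    · exact ((hP.const_mul 2).add (integrable_one_add_sq_rpow.const_mul (2 * K ^ 2))).restrict
    · refine Eventually.of_forall fun y => Tendsto.pow ?_ 2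
      rw [tendsto_iff_norm_sub_tendsto_zero]
      have hz : Tendsto (fun a : ℝ => K / a * (1 + y ^ 2) ^ (-3 / 4 : ℝ)) atTop (𝓝 0) := by
        have h0 : Tendsto (fun a : ℝ => K / a) atTop (𝓝 0) :=
          tendsto_const_nhds.div_atTop tendsto_id
        have h1 := h0.mul_const ((1 + y ^ 2) ^ (-3 / 4 : ℝ))
        rwa [zero_mul] at h1
      refine squeeze_zero' (Eventually.of_forall fun a => norm_nonneg _) ?_ hz
      filter_upwards [eventually_gt_atTop 0] with a ha using h a ha y
  refine hlim.congr' ?_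
  filter_upwards [eventually_gt_atTop 0] with a ha using (hcv a ha).symm

/-! ### The vacuum expectation of the number operator -/

lemma fieldPairing_vacuum_one (Cp Cm : Mode → ℂ) (x : Fin 1 → Mode) :
    fieldPairing Cp Cm vacuum 1 x = -conj (Cm (x 0)) := by
  simp [fieldPairing, annihilate, create, vacuum]

/-- At level zero only annihilation of the one-particle component survives; its minus sign cancels
the one in `fieldPairing`. -/
lemma numberOp_vacuum_zero (Cp Cm : Mode → ℂ) (x : Fin 0 → Mode) :
    numberOp Cp Cm vacuum 0 x = ((∫ k, ‖Cm k‖ ^ 2 ∂modeMeasure : ℝ) : ℂ) := by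
  have h : ∀ k : Mode, conj (conj (Cm k)) * fieldPairing Cp Cm vacuum (0 + 1)
      (Fin.cons k x : Fin (0 + 1) → Mode) = -((‖Cm k‖ ^ 2 : ℝ) : ℂ) := fun k => by
    have := fieldPairing_vacuum_one Cp Cm (Fin.cons k x)
    rw [Fin.cons_zero] at this
    rw [this, Complex.conj_conj, mul_neg, Complex.mul_conj, Complex.normSq_eq_norm_sq]
  simp only [numberOp, fieldPairingAdj, Pi.sub_apply, create, annihilate, h]
  rw [integral_neg, integral_complex_ofReal]
  simp

lemma vacuumNumber_eq (M e : ℝ) (fp fm : Mode → SpacetimeFun) (C : SpacetimeFun) :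
    vacuumNumber M e fp fm C =
      ((∫ k, ‖coeffMinus M e fm C k‖ ^ 2 ∂modeMeasure : ℝ) : ℂ) := by
  rw [vacuumNumber, fockInner, tsum_eq_single 0]
  · rw [Measure.pi_of_empty, integral_dirac, numberOp_vacuum_zero]
    simp [vacuum]
  · intro n hn
    obtain ⟨n, rfl⟩ := Nat.exists_eq_succ_of_ne_zero hn
    simp [vacuum]

/-! ### Normalization -/

lemma kgInner_div_right (M e c : ℝ) (u v : SpacetimeFun) :
    kgInner M e 0 u (fun x₀ ρ φ => v x₀ ρ φ / (c : ℂ)) = kgInner M e 0 u v / c := by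
  have h : ∀ ρ φ, kgIntegrand M e u (fun x₀ ρ φ => v x₀ ρ φ / (c : ℂ)) ρ φ =
      kgIntegrand M e u v ρ φ / c := fun ρ φ => by
    simp only [kgIntegrand, dTime, dRho, deriv_div_const]
    ring
  simp only [kgInner_eq, h, intervalIntegral.integral_div, integral_div]
  ring

lemma kgInner_div_left (M e c : ℝ) (u v : SpacetimeFun) :
    kgInner M e 0 (fun x₀ ρ φ => u x₀ ρ φ / (c : ℂ)) v = kgInner M e 0 u v / c := by
  have h : ∀ ρ φ, kgIntegrand M e (fun x₀ ρ φ => u x₀ ρ φ / (c : ℂ)) v ρ φ =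
      kgIntegrand M e u v ρ φ / c := fun ρ φ => by
    simp only [kgIntegrand, dTime, dRho, deriv_div_const, map_div₀, Complex.conj_ofReal]
    ring
  simp only [kgInner_eq, h, intervalIntegral.integral_div, integral_div]
  ring

/-- The norm of the packet is `a^{-ε}` times this constant. -/
noncomputable def packetNorm (ε ξ : ℝ) : ℝ :=
  √(4 * Real.pi * ξ * ((1 / 2) ^ (2 * ε) * Real.Gamma (2 * ε)))

lemma packetNorm_pos {ε ξ : ℝ} (hε : 0 < ε) (hξ : 0 < ξ) : 0 < packetNorm ε ξ := by
  have := Real.Gamma_pos_of_pos (show 0 < 2 * ε by positivity)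
  have := Real.pi_pos
  exact Real.sqrt_pos.mpr (by positivity)

lemma one_div_packetNorm_sq {ε ξ : ℝ} (hε : 0 < ε) (hξ : 0 < ξ) : 1 / packetNorm ε ξ ^ 2 =
    (2 : ℝ) ^ (2 * ε) / (4 * Real.pi * Real.Gamma (2 * ε)) * (1 / ξ) := by
  have := Real.Gamma_pos_of_pos (show 0 < 2 * ε by positivity)
  have := Real.pi_pos
  rw [packetNorm, Real.sq_sqrt (by positivity), one_div 2, Real.inv_rpow (by norm_num)]
  field_simp

lemma sqrt_kgInner_packet_self {M e η₀ ε a : ℝ} {m : ℤ} {C : SpacetimeFun} (hM : 0 < M)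
    (he : e ^ 2 < M ^ 2) (hε : 0 < ε) (ha : 0 < a) (hC : HasPacketData M e η₀ ε a m C) :
    √(kgInner M e 0 C C).re = packetNorm ε (xi0 M e η₀) / a ^ ε := by
  rw [kgInner_packet_self hM he hε ha hC, Complex.ofReal_re, packetNorm]
  have haε : 0 < a ^ ε := Real.rpow_pos_of_pos ha _
  rw [← Real.sqrt_sq haε.le, ← Real.sqrt_div' _ (sq_nonneg _), ← Real.rpow_mul_natCast ha.le]
  congr 1
  rw [one_div, mul_inv, Real.mul_rpow (by norm_num) (by positivity), Real.inv_rpow ha.le,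
    one_div, mul_comm (2 : ℝ) ε]
  push_cast
  ring

lemma kgInner_normalized_self {M e η₀ ε a : ℝ} {m : ℤ} {C : SpacetimeFun} (hM : 0 < M)
    (he : e ^ 2 < M ^ 2) (hη₀ : 0 < η₀) (hε : 0 < ε) (ha : 0 < a)
    (hC : HasPacketData M e η₀ ε a m C) :
    kgInner M e 0 (normalized M e C) (normalized M e C) = 1 := by
  have hN : 0 < √(kgInner M e 0 C C).re := by
    rw [sqrt_kgInner_packet_self hM he hε ha hC]
    exact div_pos (packetNorm_pos hε (xi0_pos hM he hη₀)) (Real.rpow_pos_of_pos ha _)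
  have hre : kgInner M e 0 C C = ((kgInner M e 0 C C).re : ℂ) := by
    rw [kgInner_packet_self hM he hε ha hC, Complex.ofReal_re]
  have h := kgInner_div_right M e (√(kgInner M e 0 C C).re) (normalized M e C) C
  have h' := kgInner_div_left M e (√(kgInner M e 0 C C).re) C C
  have hn : normalized M e C = fun x₀ ρ φ => C x₀ ρ φ / (√(kgInner M e 0 C C).re : ℂ) := rfl
  rw [← hn] at h h'
  rw [h, h', div_div, ← Complex.ofReal_mul, Real.mul_self_sqrt (Real.sqrt_pos.mp hN).le, ← hre,
    div_self]
  rw [hre]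
  exact_mod_cast (Real.sqrt_pos.mp hN).ne'

lemma kgInner_mode_normalized {M e η₀ ε a σ : ℝ} {m : ℤ} {k : Mode} {F C : SpacetimeFun}
    (hM : 0 < M) (he : e ^ 2 < M ^ 2) (hε : 0 < ε) (ha : 0 < a)
    (hF : HasModeData M e a σ k F) (hC : HasPacketData M e η₀ ε a m C) :
    kgInner M e 0 F (normalized M e C) = if k.2 = m then
      modeCoeff M e ε (xi0 M e η₀) a σ k.1 / ((packetNorm ε (xi0 M e η₀) / a ^ ε : ℝ) : ℂ) else 0 := by
  have h := kgInner_div_right M e (√(kgInner M e 0 C C).re) F C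
  rw [show normalized M e C = fun x₀ ρ φ => C x₀ ρ φ / (√(kgInner M e 0 C C).re : ℂ) from rfl, h,
    kgInner_mode_packet hM he hF hC, sqrt_kgInner_packet_self hM he hε ha hC]
  split_ifs
  · rfl
  · simp

/-- The modulus of the coefficient of the normalized packet. -/
noncomputable def normCoeff (M e ε ξ σ a η : ℝ) : ℝ :=
  a ^ ε * ‖modeCoeff M e ε ξ a σ η‖ / packetNorm ε ξ

lemma norm_modeCoeff_div {M e ε ξ σ a η : ℝ} (hε : 0 < ε) (hξ : 0 < ξ) (ha : 0 < a) :
    ‖modeCoeff M e ε ξ a σ η / ((packetNorm ε ξ / a ^ ε : ℝ) : ℂ)‖ = normCoeff M e ε ξ σ a η := by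
  have h1 := packetNorm_pos hε hξ
  have h2 := Real.rpow_pos_of_pos ha ε
  rw [norm_div, Complex.norm_real, Real.norm_of_nonneg (by positivity), normCoeff]
  field_simp

lemma continuous_normCoeff {M e ε a : ℝ} (ξ σ : ℝ) (hM : 0 < M) (he : e ^ 2 < M ^ 2) (hε : 0 < ε)
    (ha : 0 < a) : Continuous (normCoeff M e ε ξ σ a) :=
  ((continuous_modeCoeff ξ σ hM he hε ha).norm.const_mul _).div_const _

lemma abs_scaled_normCoeff_sub_le {M e ε ξ a : ℝ} (σ y : ℝ) (hM : 0 < M) (he : e ^ 2 < M ^ 2)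
    (hε : 0 < ε) (hξ : 0 < ξ) (ha : 0 < a) :
    |√a * normCoeff M e ε ξ σ a (a * y) - modeProfile ε ξ σ y / packetNorm ε ξ| ≤
      1 / √2 * remainderConst M e ε ξ / packetNorm ε ξ / a * (1 + y ^ 2) ^ (-3 / 4 : ℝ) := by
  have h1 := packetNorm_pos hε hξ
  rw [normCoeff, ← mul_div_assoc, ← sub_div, abs_div, abs_of_pos h1, div_le_iff₀ h1]
  refine (abs_scaled_modeCoeff_sub_le ξ σ y hM he hε ha).trans (le_of_eq ?_)
  field_simp

/-! ### Integrals over the mode labels -/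

instance : SFinite modeMeasure := by unfold modeMeasure; infer_instance

lemma integral_count_ite (n : ℤ) :
    ∫ j : ℤ, (if j = n then (1 : ℝ) else 0) ∂Measure.count = 1 := by
  have h : (fun j : ℤ => if j = n then (1 : ℝ) else 0) = Set.indicator {n} 1 := by
    ext j; simp [Set.indicator]
  rw [h, integral_indicator_one (measurableSet_singleton n)]
  simp [Measure.real]

lemma setIntegral_modeMeasure (S : Set ℝ) (g : ℝ → ℝ) (n : ℤ) :
    ∫ k in {k : Mode | k.1 ∈ S}, g k.1 * (if k.2 = n then 1 else 0) ∂modeMeasure =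
      ∫ η in S, g η := by
  have hset : {k : Mode | k.1 ∈ S} = S ×ˢ Set.univ := by ext k; simp
  rw [hset, modeMeasure, ← Measure.prod_restrict, Measure.restrict_univ,
    integral_prod_mul g (fun j : ℤ => if j = n then (1 : ℝ) else 0), integral_count_ite, mul_one]

lemma integrable_modeMeasure {g : ℝ → ℝ} (hg : Integrable g) (n : ℤ) :
    Integrable (fun k : Mode => g k.1 * (if k.2 = n then 1 else 0)) modeMeasure := by
  refine Integrable.mul_prod (g := fun j : ℤ => if j = n then (1 : ℝ) else 0) hg ?_
  -- A non-integrable function would have integral `0`, whereas this one has integral `1`.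
  by_contra h
  have := integral_count_ite n
  rw [integral_undef h] at this
  exact zero_ne_one this

lemma memLp_modeMeasure {c : Mode → ℂ} {h : ℝ → ℂ} {n : ℤ} (hc : Continuous h)
    (hi : Integrable fun η => ‖h η‖ ^ 2) (hch : ∀ k, c k = if k.2 = n then h k.1 else 0) :
    MemLp c 2 modeMeasure := by
  have hm : AEStronglyMeasurable c modeMeasure := by
    rw [funext hch]
    refine (Measurable.ite ?_ (hc.measurable.comp measurable_fst)
      measurable_const).aestronglyMeasurable
    exact measurable_snd (measurableSet_singleton n)
  rw [memLp_two_iff_integrable_sq_norm hm]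
  refine (integrable_modeMeasure hi n).congr (Eventually.of_forall fun k => ?_)
  simp only [hch k]
  split_ifs <;> simp

end RN

/-! ### The limit and its splitting. -/

open RN in
theorem mainTheorem1
    (M e η₀ ε : ℝ) (m : ℤ) (hM : 0 < M) (he : e ^ 2 < M ^ 2) (hη₀ : 0 < η₀) (hε : 0 < ε)
    -- for every `a > 0`: the mode functions `f_k^+`, `f_k^-` and the wave packet
    (fp fm : ℝ → RN.Mode → RN.SpacetimeFun) (C : ℝ → RN.SpacetimeFun)
    (hfp : ∀ a : ℝ, 0 < a → ∀ k, RN.HasModeData M e a (-1) k (fp a k))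
    (hfm : ∀ a : ℝ, 0 < a → ∀ k, RN.HasModeData M e a 1 k (fm a k))
    (hC : ∀ a : ℝ, 0 < a → RN.HasPacketData M e η₀ ε a m (C a)) :
    -- the normalized packet has norm one and square-integrable coefficients
    (∀ a : ℝ, 0 < a →
      RN.kgInner M e 0 (RN.normalized M e (C a)) (RN.normalized M e (C a)) = 1 ∧
      MemLp (RN.coeffPlus M e (fp a) (RN.normalized M e (C a))) 2 RN.modeMeasure ∧
      MemLp (RN.coeffMinus M e (fm a) (RN.normalized M e (C a))) 2 RN.modeMeasure) ∧
    -- the limit of the average number of particles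
    Integrable (RN.C3 ε (RN.xi0 M e η₀)) ∧
    Tendsto (fun a => RN.vacuumNumber M e (fp a) (fm a) (RN.normalized M e (C a))) atTop
      (𝓝 (((2 : ℝ) ^ (2 * ε) / (4 * Real.pi * Real.Gamma (2 * ε)) *
        ∫ η : ℝ, 1 / RN.xi0 M e η₀ * RN.C3 ε (RN.xi0 M e η₀) η : ℝ) : ℂ)) ∧
    -- its splitting
    Tendsto (fun a => RN.vacuumNumber M e (fp a) (fm a) (RN.normalized M e (C a))) atTop
      (𝓝 ((RN.Iplus ε (RN.xi0 M e η₀) + RN.Iminus ε (RN.xi0 M e η₀) : ℝ) : ℂ)) ∧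
    Tendsto (fun a => ∫ k in {k : RN.Mode | 0 < k.1},
        (‖RN.coeffMinus M e (fm a) (RN.normalized M e (C a)) k‖ ^ 2) ∂(RN.modeMeasure)) atTop
      (𝓝 (RN.Iplus ε (RN.xi0 M e η₀))) ∧
    Tendsto (fun a => ∫ k in {k : RN.Mode | k.1 < 0},
        (‖RN.coeffMinus M e (fm a) (RN.normalized M e (C a)) k‖ ^ 2) ∂(RN.modeMeasure)) atTop
      (𝓝 (RN.Iminus ε (RN.xi0 M e η₀))) := by
  have hξ := xi0_pos (η₀ := η₀) hM he hη₀
  set ξ := xi0 M e η₀ with hξdef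
  have hN := packetNorm_pos hε hξ
  have hPint : ∀ σ : ℝ, |σ| ≤ 1 → Integrable fun y => (modeProfile ε ξ σ y / packetNorm ε ξ) ^ 2 := by
    intro σ hσ
    simp only [div_pow]
    exact (integrable_modeProfile_sq ξ hε hσ).div_const _
  have hplus : ∀ a, 0 < a → ∀ k, coeffPlus M e (fp a) (normalized M e (C a)) k =
      if k.2 = m then modeCoeff M e ε ξ a (-1) k.1 / ((packetNorm ε ξ / a ^ ε : ℝ) : ℂ) else 0 :=
    fun a ha k => kgInner_mode_normalized hM he hε ha (hfp a ha k) (hC a ha)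
  -- The label `-k` reverses both entries, so the support is `m' = -m` and the profile appears at
  -- `-η`, matching `C3_eq`.
  have hminus : ∀ a, 0 < a → ∀ k, coeffMinus M e (fm a) (normalized M e (C a)) k =
      if k.2 = -m then
        -(modeCoeff M e ε ξ a 1 (-k.1) / ((packetNorm ε ξ / a ^ ε : ℝ) : ℂ)) else 0 := by
    intro a ha k
    rw [coeffMinus, kgInner_mode_normalized hM he hε ha (hfm a ha (-k)) (hC a ha)]
    simp only [Prod.snd_neg, Prod.fst_neg, neg_eq_iff_eq_neg]
    split_ifs <;> simp [hξdef]
  have hbound : ∀ a, 0 < a → ∀ y, |√a * normCoeff M e ε ξ 1 a (-(a * y)) -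
      modeProfile ε ξ 1 (-y) / packetNorm ε ξ| ≤
      1 / √2 * remainderConst M e ε ξ / packetNorm ε ξ / a * (1 + y ^ 2) ^ (-3 / 4 : ℝ) := by
    intro a ha y
    have h := abs_scaled_normCoeff_sub_le 1 (-y) hM he hε hξ ha
    rwa [neg_sq, mul_neg] at h
  have hcont : ∀ a, 0 < a → Continuous fun η => normCoeff M e ε ξ 1 a (-η) := fun a ha =>
    (continuous_normCoeff ξ 1 hM he hε ha).comp continuous_neg
  have hPneg : Integrable fun y => (modeProfile ε ξ 1 (-y) / packetNorm ε ξ) ^ 2 :=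
    (hPint 1 (by simp)).comp_neg
  have hP : ∀ S : Set ℝ, ∫ y in S, (modeProfile ε ξ 1 (-y) / packetNorm ε ξ) ^ 2 =
      (2 : ℝ) ^ (2 * ε) / (4 * Real.pi * Real.Gamma (2 * ε)) * ∫ y in S, 1 / ξ * C3 ε ξ y := by
    intro S
    rw [← integral_const_mul]
    congr 1 with y
    rw [div_pow, C3_eq, ← mul_assoc, ← one_div_packetNorm_sq hε hξ]
    ring
  -- One statement for all cones `S`: the whole line gives the total, the two open half-lines give
  -- `I₊` and `I₋`.
  have hlim : ∀ S : Set ℝ, MeasurableSet S → (∀ a, 0 < a → ∀ y, a * y ∈ S ↔ y ∈ S) →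
      Tendsto (fun a => ∫ k in {k : Mode | k.1 ∈ S},
        ‖coeffMinus M e (fm a) (normalized M e (C a)) k‖ ^ 2 ∂modeMeasure) atTop
      (𝓝 ((2 : ℝ) ^ (2 * ε) / (4 * Real.pi * Real.Gamma (2 * ε)) *
        ∫ y in S, 1 / ξ * C3 ε ξ y)) := by
    intro S hS hscale
    have h := tendsto_setIntegral_sq_of_scaled hS hscale hcont hPneg hbound
    rw [hP S] at h
    refine h.congr' ?_
    filter_upwards [eventually_gt_atTop 0] with a ha
    rw [← setIntegral_modeMeasure S _ (-m)]
    congr 1 with k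
    rw [hminus a ha k]
    split_ifs
    · rw [norm_neg, norm_modeCoeff_div hε hξ ha, mul_one]
    · simp
  have hall := hlim Set.univ MeasurableSet.univ (fun a _ y => by simp)
  simp only [Set.mem_univ, Set.ofPred_true, Measure.restrict_univ] at hall
  have hvac : Tendsto (fun a => vacuumNumber M e (fp a) (fm a) (normalized M e (C a))) atTop
      (𝓝 (((2 : ℝ) ^ (2 * ε) / (4 * Real.pi * Real.Gamma (2 * ε)) *
        ∫ η : ℝ, 1 / ξ * C3 ε ξ η : ℝ) : ℂ)) := by
    simp only [vacuumNumber_eq]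
    exact (Complex.continuous_ofReal.tendsto _).comp hall
  have hC3 := integrable_C3 ξ hε
  have hsplit : (2 : ℝ) ^ (2 * ε) / (4 * Real.pi * Real.Gamma (2 * ε)) *
      ∫ η : ℝ, 1 / ξ * C3 ε ξ η = Iplus ε ξ + Iminus ε ξ := by
    have hi := hC3.const_mul (1 / ξ)
    rw [← intervalIntegral.integral_Iic_add_Ioi (b := 0) hi.integrableOn hi.integrableOn,
      integral_Iic_eq_integral_Iio, Iplus, Iminus]
    ring
  refine ⟨fun a ha => ⟨kgInner_normalized_self hM he hη₀ hε ha (hC a ha), ?_, ?_⟩, hC3, hvac,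
    hsplit ▸ hvac, ?_, ?_⟩
  · refine memLp_modeMeasure ((continuous_modeCoeff ξ (-1) hM he hε ha).div_const _) ?_ (hplus a ha)
    simp only [norm_modeCoeff_div hε hξ ha]
    exact integrable_sq_of_scaled ha (continuous_normCoeff ξ (-1) hM he hε ha)
      (hPint (-1) (by simp)) fun y => abs_scaled_normCoeff_sub_le (-1) y hM he hε hξ ha
  · refine memLp_modeMeasure (h := fun η =>
      -(modeCoeff M e ε ξ a 1 (-η) / ((packetNorm ε ξ / a ^ ε : ℝ) : ℂ)))
      (((continuous_modeCoeff ξ 1 hM he hε ha).comp continuous_neg).div_const _).neg ?_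
      (hminus a ha)
    simp only [norm_neg, norm_modeCoeff_div hε hξ ha]
    exact integrable_sq_of_scaled ha (hcont a ha) hPneg (hbound a ha)
  · exact hlim (Set.Ioi 0) measurableSet_Ioi fun a ha y => by simp [ha]
  · exact hlim (Set.Iio 0) measurableSet_Iio fun a ha y => by
      simp only [Set.mem_Iio, mul_neg_iff, ha, ha.le.not_gt, true_and, false_and, or_false]
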